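/- Let $\alpha,\beta>-1$, $\omega^{\alpha,\beta}(x)=(1-x)^\alpha(1+x)^\beta$ on $I=(-1,1)$, and let $J_n^{\alpha,\beta}$ be the Jacobi polynomials in Szegő's normalization, i.e. $$(1-x)^\alpha(1+x)^\beta J_n^{\alpha,\beta}(x)=\frac{(-1)^n}{2^n n!}\frac{d^n}{dx^n}\big[(1-x)^{\alpha+n}(1+x)^{\beta+n}\big],\qquad x\in I,\ n\ge 0.$$ Put $$\gamma_n^{\alpha,\beta}=\frac{2^{\alpha+\beta+1}\Gamma(n+\alpha+1)\Gamma(n+\beta+1)}{(2n+\alpha+\beta+1)\,n!\,\Gamma(n+\alpha+\beta+1)},$$ where for $n=0$ this is read as $\gamma_0^{\alpha,\beta}=2^{\alpha+\beta+1}\Gamma(\alpha+1)\Gamma(\beta+1)/\Gamma(\alpha+\beta+2)$ (the same value, by continuity also for $\alpha+\beta=-1$). For $\rho>1$ let $\mathcal E_\rho=\{\tfrac12(w+w^{-1}) : w=\rho e^{i\theta},\ \theta\in[0,2\pi]\}$ be the Bernstein ellipse, and let $\mathcal A_\rho$ be the set of complex functions $u$ that are analytic on and within $\mathcal E_\rho$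 (i.e. in a neighbourhood of each point of the closed region bounded by $\mathcal E_\rho$). For $u\in\mathcal A_\rho$ and $N\ge 1$ let $$M=\max_{z\in\mathcal E_\rho}|u(z)|,\qquad \hat u_n^{\alpha,\beta}=\frac1{\gamma_n^{\alpha,\beta}}\int_{-1}^1 u(x)J_n^{\alpha,\beta}(x)\,\omega^{\alpha,\beta}(x)\,dx,\qquad \pi_N^{\alpha,\beta}u=\sum_{n=0}^{N-1}\hat u_n^{\alpha,\beta}J_n^{\alpha,\beta},$$ and $\|f\|_{\omega^{\alpha,\beta}}=\big(\int_{-1}^1|f|^2\,\omega^{\alpha,\beta}\,dx\big)^{1/2}$. **Theorem.** For all $\alpha,\beta>-1$ there is a sequence of real numbers $(C_N)_{N\ge1}$, depending only on $\alpha$ and $\beta$, with $C_N=1+O(N^{-1})$ as $N\to\infty$, such that for all $\rho>1$, all $u\in\mathcal A_\rho$ and all $N\ge 1$, $$\big\|\pi_N^{\alpha,\beta}u-u\big\|_{\omega^{\alpha,\beta}}\le\bigg[\sqrt{\frac{\pi}{2^{\alpha+\beta}}}\Big(1+\frac{|\alpha-\beta|}{\rho}\Big)+\frac{2\sqrt{\gamma_0^{\alpha,\beta}}}{\rho(\rho-1)}\bigg]\frac{C_N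 M}{\rho^{N-1}\sqrt{\rho^2-1}}.$$ -/

import Mathlib

open MeasureTheory

noncomputable section

/-- The Jacobi weight `(1 - x) ^ α * (1 + x) ^ β` (used for `x` in `(-1, 1)`). -/
def jacobiWeight (α β x : ℝ) : ℝ := (1 - x) ^ α * (1 + x) ^ β

/-- The Jacobi polynomial of degree `n` on `(-1, 1)`, by Rodrigues' formula
`(1 - x) ^ α (1 + x) ^ β J_n(x) = (-1) ^ n / (2 ^ n n!) dⁿ/dxⁿ [(1 - x) ^ (α + n) (1 + x) ^ (β + n)]`
(Szegő's normalization). Its values are only used for `x` in `(-1, 1)`. -/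
def jacobiP (α β : ℝ) (n : ℕ) (x : ℝ) : ℝ :=
  (-1) ^ n / (2 ^ n * (n.factorial : ℝ))
    * iteratedDeriv n (fun t : ℝ => (1 - t) ^ (α + n) * (1 + t) ^ (β + n)) x
    / jacobiWeight α β x

/-- The normalization factor `γ_n`. For `n = 0` the factor `(α + β + 1) Γ(α + β + 1)` in the
denominator is written as `Γ(α + β + 2)`, which is its value, by continuity also at
`α + β = -1`. -/
def jacobiGamma (α β : ℝ) (n : ℕ) : ℝ :=
  if n = 0 then
    2 ^ (α + β + 1) * Real.Gamma (α + 1) * Real.Gamma (β + 1) / Real.Gamma (α + β + 2)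
  else
    2 ^ (α + β + 1) * Real.Gamma (n + α + 1) * Real.Gamma (n + β + 1)
      / ((2 * n + α + β + 1) * (n.factorial : ℝ) * Real.Gamma (n + α + β + 1))

/-- The usual formula for `γ_n` is valid for all `n`, except where it reads `0 · Γ(0)`. -/
theorem jacobiGamma_eq (α β : ℝ) (n : ℕ) (h : n ≠ 0 ∨ α + β + 1 ≠ 0) :
    jacobiGamma α β n = 2 ^ (α + β + 1) * Real.Gamma (n + α + 1) * Real.Gamma (n + β + 1)
      / ((2 * n + α + β + 1) * (n.factorial : ℝ) * Real.Gamma (n + α + β + 1)) := by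
  unfold jacobiGamma
  split_ifs with hn
  · subst hn
    have h' : α + β + 1 ≠ 0 := by tauto
    have e := Real.Gamma_add_one h'
    have e2 : α + β + 2 = α + β + 1 + 1 := by ring
    rw [e2, e]
    simp
  · rfl

/-- The Bernstein ellipse: the points `(w + w⁻¹) / 2` with `w = ρ e ^ (iθ)`, `θ ∈ [0, 2π]`. -/
def bernsteinEllipse (ρ : ℝ) : Set ℂ :=
  {z | ∃ θ ∈ Set.Icc (0 : ℝ) (2 * Real.pi), ∃ w : ℂ,
    w = (ρ : ℂ) * Complex.exp (Complex.I * (θ : ℂ)) ∧ z = (w + w⁻¹) / 2}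

/-- The points on and within the Bernstein ellipse, whose semi-axes are
`(ρ + ρ⁻¹) / 2` and `(ρ - ρ⁻¹) / 2`. -/
def bernsteinRegion (ρ : ℝ) : Set ℂ :=
  {z | (z.re / ((ρ + ρ⁻¹) / 2)) ^ 2 + (z.im / ((ρ - ρ⁻¹) / 2)) ^ 2 ≤ 1}

/-- The functions which are analytic on and within the Bernstein ellipse, that is, analytic
in a neighbourhood of each point of the closed elliptic region. -/
def bernsteinAnalytic (ρ : ℝ) : Set (ℂ → ℂ) :=
  {u | AnalyticOnNhd ℂ u (bernsteinRegion ρ)}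

/-- `M`, the maximum of `|u|` over the Bernstein ellipse. -/
def bernsteinMax (ρ : ℝ) (u : ℂ → ℂ) : ℝ :=
  sSup ((fun z => ‖u z‖) '' bernsteinEllipse ρ)

/-- The coefficients of the Jacobi expansion of `u`. -/
def jacobiCoeff (α β : ℝ) (u : ℂ → ℂ) (n : ℕ) : ℂ :=
  ((jacobiGamma α β n)⁻¹ : ℝ) *
    ∫ x in (-1 : ℝ)..1, u (x : ℂ) * (jacobiP α β n x : ℂ) * (jacobiWeight α β x : ℂ)

/-- The truncated Jacobi expansion, with the `N` terms of degree at most `N - 1`. -/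
def jacobiProj (α β : ℝ) (N : ℕ) (u : ℂ → ℂ) (x : ℝ) : ℂ :=
  ∑ n ∈ Finset.range N, jacobiCoeff α β u n * (jacobiP α β n x : ℂ)

/-- The measure `(1 - x) ^ α (1 + x) ^ β dx` on `(-1, 1)`. -/
def jacobiMeasure (α β : ℝ) : Measure ℝ :=
  (volume.restrict (Set.Ioo (-1 : ℝ) 1)).withDensity
    (fun x => ENNReal.ofReal (jacobiWeight α β x))

/-- The norm of the weighted `L²` space on `(-1, 1)`, as an extended nonnegative real number. -/
def jacobiL2Norm (α β : ℝ) (f : ℝ → ℂ) : ENNReal :=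
  eLpNorm f 2 (jacobiMeasure α β)

end

/-! Expand `u` in Chebyshev polynomials, `u = ∑ b k T_k`. The `b k` are, up to a factor 2, Laurent
coefficients of `u ((w + w⁻¹) / 2)`, so moving the contour to `|w| = ρ` gives `‖b k‖ ≤ 2 M ρ⁻ᵏ`
(`exists_chebyshev_expansion`). Let `e_n` be the normalized Jacobi polynomials. By orthogonality the
coefficient of `u` along `e_n` is `∑ b k ⟨e_n, T_k⟩` over `k ≥ n` only. The first two inner products
are computed exactly by integrating Rodrigues' formula by parts `n` times: both are multiples of
`jacobiInt (α + n) (β + n) 1`, the second one carrying the factor `β - α`, because `T_{n+1}` has no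
term of degree `n`. The duplication formula and Gamma quotient asymptotics show that this integral
over `√γ_n` is at most `√(π / 2^(α+β)) (1 + K / n)` (`exists_jacobiInt_le`). For `k ≥ n + 2`,
Cauchy–Schwarz and `|T_k| ≤ 1` give the bound `√γ_0`. A geometric sum over `k` bounds the
coefficient by `A ρ⁻ⁿ`, and Parseval over `n ≥ N` gives the error `A ρ⁻ᴺ / √(1 - ρ⁻²)`
(`Orthonormal.norm_sub_sum_inner_le`). -/

open Polynomial in
/-- The integral of a polynomial against the Jacobi weight. -/
noncomputable def jacobiInt (a b : ℝ) (p : ℝ[X]) : ℝ :=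
  ∫ x in Set.Ioo (-1 : ℝ) 1, jacobiWeight a b x * p.eval x

open Polynomial in
/-- The first order operator `L` with `(w ^ {a,b} p)' = w ^ {a-1,b-1} L p`. -/
noncomputable def jacobiStep (a b : ℝ) (p : ℝ[X]) : ℝ[X] :=
  (C (b - a) - C (a + b) * X) * p + (1 - X ^ 2) * derivative p

open Polynomial in
/-- The polynomial factor of the `i`-th derivative of `(1 - x) ^ a (1 + x) ^ b`. -/
noncomputable def jacobiRod (a b : ℝ) : ℕ → ℝ[X]
  | 0 => 1
  | i + 1 => jacobiStep (a - i) (b - i) (jacobiRod a b i)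

open Polynomial in
/-- The Jacobi polynomial as an element of `ℝ[X]`. -/
noncomputable def jacobiPoly (α β : ℝ) (n : ℕ) : ℝ[X] :=
  C ((-1) ^ n / (2 ^ n * (n.factorial : ℝ))) * jacobiRod (α + n) (β + n) n

/-! ### The Jacobi weight, integration by parts and Rodrigues' formula. -/

section Weight

theorem jacobiWeight_pos {a b x : ℝ} (hx : x ∈ Set.Ioo (-1 : ℝ) 1) : 0 < jacobiWeight a b x :=
  mul_pos (Real.rpow_pos_of_pos (by linarith [hx.2]) _) (Real.rpow_pos_of_pos (by linarith [hx.1]) _)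

theorem jacobiWeight_add_one {a b x : ℝ} (hx : x ∈ Set.Ioo (-1 : ℝ) 1) :
    jacobiWeight (a + 1) (b + 1) x = jacobiWeight a b x * (1 - x ^ 2) := by
  unfold jacobiWeight
  rw [Real.rpow_add_one (by linarith [hx.2]), Real.rpow_add_one (by linarith [hx.1])]
  ring

theorem measurable_jacobiWeight (a b : ℝ) : Measurable (jacobiWeight a b) := by
  unfold jacobiWeight
  fun_prop

/-- Split at 0, so that each half has at most one singular factor. -/
theorem intervalIntegrable_jacobiWeight {a b : ℝ} (ha : -1 < a) (hb : -1 < b) :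
    IntervalIntegrable (jacobiWeight a b) volume (-1) 1 := by
  have h1 : IntervalIntegrable (fun x : ℝ => (1 + x) ^ b) volume (-1) 0 := by
    have := (intervalIntegral.intervalIntegrable_rpow' (a := 0) (b := 1) hb).comp_add_left 1
    simpa using this
  have h2 : IntervalIntegrable (fun x : ℝ => (1 - x) ^ a) volume 0 1 := by
    have := (intervalIntegral.intervalIntegrable_rpow' (a := 1) (b := 0) ha).comp_sub_left 1
    simpa using this
  refine IntervalIntegrable.trans (b := 0) ?_ ?_
  · refine h1.continuousOn_mul ?_
    intro x hx
    rw [Set.uIcc_of_le (by norm_num)] at hx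
    exact ((continuousAt_const.sub continuousAt_id).rpow_const
      (Or.inl (by simp only [Pi.sub_apply, id]; linarith [hx.2]))).continuousWithinAt
  · refine h2.mul_continuousOn ?_
    intro x hx
    rw [Set.uIcc_of_le (by norm_num)] at hx
    exact ((continuousAt_const.add continuousAt_id).rpow_const
      (Or.inl (by simp only [Pi.add_apply, id]; linarith [hx.1]))).continuousWithinAt

theorem integrableOn_jacobiWeight {a b : ℝ} (ha : -1 < a) (hb : -1 < b) :
    IntegrableOn (jacobiWeight a b) (Set.Ioo (-1) 1) :=
  (intervalIntegrable_iff_integrableOn_Ioo_of_le (by norm_num)).1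
    (intervalIntegrable_jacobiWeight ha hb)

theorem integrableOn_jacobiWeight_mul {a b : ℝ} (ha : -1 < a) (hb : -1 < b) (p : Polynomial ℝ) :
    IntegrableOn (fun x => jacobiWeight a b x * p.eval x) (Set.Ioo (-1) 1) :=
  (intervalIntegrable_iff_integrableOn_Ioo_of_le (by norm_num)).1
    ((intervalIntegrable_jacobiWeight ha hb).mul_continuousOn p.continuous.continuousOn)

theorem hasDerivAt_jacobiWeight_mul (a b : ℝ) (p : Polynomial ℝ) {x : ℝ}
    (hx : x ∈ Set.Ioo (-1 : ℝ) 1) :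
    HasDerivAt (fun t => jacobiWeight a b t * p.eval t)
      (jacobiWeight (a - 1) (b - 1) x * (jacobiStep a b p).eval x) x := by
  have h1 : 0 < 1 - x := by linarith [hx.2]
  have h2 : 0 < 1 + x := by linarith [hx.1]
  have d1 := ((hasDerivAt_id x).const_sub 1).rpow_const (p := a) (Or.inl h1.ne')
  have d2 := ((hasDerivAt_id x).const_add 1).rpow_const (p := b) (Or.inl h2.ne')
  refine ((d1.mul d2).mul (p.hasDerivAt x)).congr_deriv ?_
  simp only [jacobiStep, jacobiWeight, id]
  have e1 : (1 - x) ^ a = (1 - x) ^ (a - 1) * (1 - x) := by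
    rw [← Real.rpow_add_one h1.ne']; simp
  have e2 : (1 + x) ^ b = (1 + x) ^ (b - 1) * (1 + x) := by
    rw [← Real.rpow_add_one h2.ne']; simp
  simp only [Pi.mul_apply, e1, e2]
  simp
  ring

theorem jacobiInt_add {a b : ℝ} (ha : -1 < a) (hb : -1 < b) (p q : Polynomial ℝ) :
    jacobiInt a b (p + q) = jacobiInt a b p + jacobiInt a b q := by
  unfold jacobiInt
  rw [← integral_add (integrableOn_jacobiWeight_mul ha hb p) (integrableOn_jacobiWeight_mul ha hb q)]
  simp [mul_add]

theorem jacobiInt_C_mul (a b c : ℝ) (p : Polynomial ℝ) :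
    jacobiInt a b (Polynomial.C c * p) = c * jacobiInt a b p := by
  unfold jacobiInt
  rw [← integral_const_mul]
  simp [mul_left_comm]

theorem jacobiInt_one_sub_sq_mul (a b : ℝ) (p : Polynomial ℝ) :
    jacobiInt a b ((1 - Polynomial.X ^ 2) * p) = jacobiInt (a + 1) (b + 1) p := by
  unfold jacobiInt
  refine setIntegral_congr_fun measurableSet_Ioo fun x hx => ?_
  simp [jacobiWeight_add_one hx, mul_assoc]

theorem jacobiInt_step {a b : ℝ} (ha : 0 < a) (hb : 0 < b) (p : Polynomial ℝ) :
    jacobiInt (a - 1) (b - 1) (jacobiStep a b p) = 0 := by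
  have hi := integrableOn_jacobiWeight_mul (a := a - 1) (b := b - 1) (by linarith) (by linarith)
    (jacobiStep a b p)
  have := intervalIntegral.integral_eq_sub_of_hasDerivAt_of_le (a := -1) (b := 1) (by norm_num)
    (f := fun t => jacobiWeight a b t * p.eval t) ?_
    (fun x hx => hasDerivAt_jacobiWeight_mul a b p hx)
    ((intervalIntegrable_iff_integrableOn_Ioo_of_le (by norm_num)).2 hi)
  · rw [jacobiInt, ← integral_Ioc_eq_integral_Ioo, ← intervalIntegral.integral_of_le (by norm_num),
      this]
    simp [jacobiWeight, Real.zero_rpow ha.ne', Real.zero_rpow hb.ne']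
  · refine (Continuous.mul ?_ p.continuous).continuousOn
    exact ((continuous_const.sub continuous_id).rpow_const fun _ => Or.inr ha.le).mul
      ((continuous_const.add continuous_id).rpow_const fun _ => Or.inr hb.le)

theorem jacobiStep_mul (a b : ℝ) (p q : Polynomial ℝ) :
    jacobiStep a b (q * p) = q * jacobiStep a b p + (1 - Polynomial.X ^ 2) *
      (Polynomial.derivative q * p) := by
  simp only [jacobiStep, Polynomial.derivative_mul]
  ring

/-- Integration by parts: the total derivative integrates to zero as both exponents are positive,
and the factor `1 - X ^ 2` in front of `derivative q` raises the exponents by one. -/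
theorem jacobiInt_mul_step {a b : ℝ} (ha : 0 < a) (hb : 0 < b) (p q : Polynomial ℝ) :
    jacobiInt (a - 1) (b - 1) (q * jacobiStep a b p) =
      -jacobiInt a b (Polynomial.derivative q * p) := by
  have h := jacobiInt_step ha hb (q * p)
  rw [jacobiStep_mul, jacobiInt_add (by linarith) (by linarith), jacobiInt_one_sub_sq_mul,
    sub_add_cancel, sub_add_cancel] at h
  linarith

/-- The hypotheses `i - 1 < a, b` keep the exponents positive in each of the `i` integrations by
parts. -/
theorem jacobiInt_mul_rod (a b : ℝ) (i : ℕ) (ha : i - 1 < a) (hb : i - 1 < b) (q : Polynomial ℝ) :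
    jacobiInt (a - i) (b - i) (q * jacobiRod a b i) =
      (-1) ^ i * jacobiInt a b (Polynomial.derivative^[i] q) := by
  induction i generalizing q with
  | zero => simp [jacobiRod]
  | succ i ih =>
    push_cast at ha hb ⊢
    rw [jacobiRod, ← sub_sub, ← sub_sub, jacobiInt_mul_step (by linarith) (by linarith),
      ih (by linarith) (by linarith), Function.iterate_succ_apply]
    ring

theorem jacobiInt_mul_jacobiPoly {α β : ℝ} (hα : -1 < α) (hβ : -1 < β) (n : ℕ)
    (q : Polynomial ℝ) :
    jacobiInt α β (q * jacobiPoly α β n) = (2 ^ n * (n.factorial : ℝ))⁻¹ *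
      jacobiInt (α + n) (β + n) (Polynomial.derivative^[n] q) := by
  have h := jacobiInt_mul_rod (α + n) (β + n) n (by linarith) (by linarith) q
  rw [add_sub_cancel_right, add_sub_cancel_right] at h
  rw [jacobiPoly, mul_left_comm, jacobiInt_C_mul, h, ← mul_assoc, div_mul_eq_mul_div, ← mul_pow]
  simp

theorem iteratedDeriv_jacobiWeight (a b : ℝ) (i : ℕ) {x : ℝ} (hx : x ∈ Set.Ioo (-1 : ℝ) 1) :
    iteratedDeriv i (jacobiWeight a b) x =
      jacobiWeight (a - i) (b - i) x * (jacobiRod a b i).eval x := by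
  induction i generalizing x with
  | zero => simp [jacobiRod]
  | succ i ih =>
    have he : iteratedDeriv i (jacobiWeight a b) =ᶠ[nhds x]
        fun t => jacobiWeight (a - i) (b - i) t * (jacobiRod a b i).eval t := by
      filter_upwards [isOpen_Ioo.mem_nhds hx] with t ht using ih ht
    rw [iteratedDeriv_succ, he.deriv_eq, (hasDerivAt_jacobiWeight_mul _ _ _ hx).deriv, jacobiRod]
    push_cast
    rw [sub_sub, sub_sub]

theorem jacobiP_eq_eval (α β : ℝ) (n : ℕ) {x : ℝ} (hx : x ∈ Set.Ioo (-1 : ℝ) 1) :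
    jacobiP α β n x = (jacobiPoly α β n).eval x := by
  have h := iteratedDeriv_jacobiWeight (α + n) (β + n) n hx
  have hw := (jacobiWeight_pos (a := α) (b := β) hx).ne'
  rw [add_sub_cancel_right, add_sub_cancel_right] at h
  have e : (fun t : ℝ => (1 - t) ^ (α + n) * (1 + t) ^ (β + n)) =
    jacobiWeight (α + n) (β + n) := rfl
  rw [jacobiP, e, h, jacobiPoly, Polynomial.eval_mul, Polynomial.eval_C]
  field_simp

-- On leading terms, step `i` multiplies by `-(a + b - 2i) - i = -(a + b - i)`.
open Polynomial in
theorem coeff_jacobiRod (a b : ℝ) (i : ℕ) :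
    (jacobiRod a b i).natDegree ≤ i ∧
      (jacobiRod a b i).coeff i = (-1) ^ i * ∏ j ∈ Finset.range i, (a + b - j) := by
  induction i with
  | zero => simp [jacobiRod]
  | succ i ih =>
    obtain ⟨hd, hc⟩ := ih
    set p := jacobiRod a b i with hp
    have e : jacobiRod a b (i + 1) = C (b - a) * p - C (a + b - 2 * i) * (X * p)
        + (derivative p - X * (X * derivative p)) := by
      rw [jacobiRod, jacobiStep, ← hp]
      have h1 : b - i - (a - i) = b - a := by ring
      have h2 : a - i + (b - i) = a + b - 2 * i := by ring
      rw [h1, h2]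
      ring
    have hz : ∀ k, i < k → p.coeff k = 0 := fun k hk =>
      coeff_eq_zero_of_natDegree_lt (lt_of_le_of_lt hd hk)
    constructor
    · rw [natDegree_le_iff_coeff_eq_zero]
      intro k hk
      obtain ⟨k, rfl⟩ : ∃ m, k = m + 2 := ⟨k - 2, by omega⟩
      rw [e]
      simp only [coeff_add, coeff_sub, coeff_C_mul, coeff_X_mul, coeff_derivative]
      rw [hz _ (by omega), hz (k + 1) (by omega), hz (k + 2 + 1) (by omega)]
      simp
    · rw [e]
      simp only [coeff_add, coeff_sub, coeff_C_mul, coeff_X_mul, coeff_derivative]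
      rw [hz _ (by omega), hz (i + 1 + 1) (by omega), hc, Finset.prod_range_succ]
      rcases i with _ | i
      · simp
      · rw [coeff_X_mul, coeff_derivative, hc]
        push_cast
        ring

theorem prod_sub_eq_Gamma {s : ℝ} (n : ℕ) (hs : (n : ℝ) - 1 < s) :
    ∏ j ∈ Finset.range n, (s - j) = Real.Gamma (s + 1) / Real.Gamma (s - n + 1) := by
  induction n with
  | zero =>
    have : Real.Gamma (s + 1) ≠ 0 := (Real.Gamma_pos_of_pos (by simp at hs; linarith)).ne'
    simp [this]
  | succ n ih =>
    push_cast at hs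
    have h1 : 0 < s - n := by linarith
    rw [Finset.prod_range_succ, ih (by linarith), Real.Gamma_add_one h1.ne']
    have e : s - ((n + 1 : ℕ) : ℝ) + 1 = s - n := by push_cast; ring
    rw [e]
    have := (Real.Gamma_pos_of_pos h1).ne'
    field_simp

theorem natDegree_jacobiPoly_le (α β : ℝ) (n : ℕ) : (jacobiPoly α β n).natDegree ≤ n :=
  (Polynomial.natDegree_C_mul_le _ _).trans (coeff_jacobiRod _ _ n).1

/-- For `n = 0` the quotient breaks down at the pole `α + β = -1`. -/
theorem coeff_jacobiPoly {α β : ℝ} (hα : -1 < α) (hβ : -1 < β) {n : ℕ} (hn : n ≠ 0) :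
    (jacobiPoly α β n).coeff n = Real.Gamma (2 * n + α + β + 1) /
      (2 ^ n * (n.factorial : ℝ) * Real.Gamma (n + α + β + 1)) := by
  have hn1 : (1 : ℝ) ≤ n := by exact_mod_cast Nat.one_le_iff_ne_zero.2 hn
  rw [jacobiPoly, Polynomial.coeff_C_mul, (coeff_jacobiRod _ _ n).2,
    prod_sub_eq_Gamma n (by linarith)]
  have e1 : α + n + (β + n) + 1 = 2 * n + α + β + 1 := by ring
  have e2 : α + n + (β + n) - n + 1 = n + α + β + 1 := by ring
  rw [e1, e2]
  have : ((-1 : ℝ) ^ n) * (-1) ^ n = 1 := by rw [← mul_pow]; simp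
  rw [← mul_assoc, div_mul_eq_mul_div, this]
  field_simp

/-! ### Moments of the weight and integrals against Jacobi polynomials. -/

theorem jacobiInt_one {a b : ℝ} (ha : -1 < a) (hb : -1 < b) :
    jacobiInt a b 1 = 2 ^ (a + b + 1) * (Real.Gamma (a + 1) * Real.Gamma (b + 1) /
      Real.Gamma (a + b + 2)) := by
  have h := Complex.betaIntegral_eq_Gamma_mul_div ((b + 1 : ℝ) : ℂ) ((a + 1 : ℝ) : ℂ)
    (by simp; linarith) (by simp; linarith)
  have h2 : Complex.betaIntegral ((b + 1 : ℝ) : ℂ) ((a + 1 : ℝ) : ℂ) =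
      ((∫ x in (0 : ℝ)..1, x ^ b * (1 - x) ^ a : ℝ) : ℂ) := by
    rw [Complex.betaIntegral, ← intervalIntegral.integral_ofReal]
    refine intervalIntegral.integral_congr fun x hx => ?_
    rw [Set.uIcc_of_le (by norm_num)] at hx
    have hx1 : 0 ≤ 1 - x := by linarith [hx.2]
    rw [Complex.ofReal_mul, Complex.ofReal_cpow hx.1, Complex.ofReal_cpow hx1]
    simp
  rw [h2, ← Complex.ofReal_add, Complex.Gamma_ofReal, Complex.Gamma_ofReal, Complex.Gamma_ofReal,
    ← Complex.ofReal_mul, ← Complex.ofReal_div, Complex.ofReal_inj] at h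
  -- The substitution `x ↦ 2 x - 1` reduces the integral to Euler's Beta integral.
  have h3 := intervalIntegral.integral_comp_mul_sub (a := 0) (b := 1) (c := 2)
    (jacobiWeight a b) (by norm_num) 1
  have h4 : ∫ x in (0 : ℝ)..1, jacobiWeight a b (2 * x - 1) =
      2 ^ (a + b) * ∫ x in (0 : ℝ)..1, x ^ b * (1 - x) ^ a := by
    rw [← intervalIntegral.integral_const_mul]
    refine intervalIntegral.integral_congr fun x hx => ?_
    rw [Set.uIcc_of_le (by norm_num)] at hx
    have hx1 : 0 ≤ 1 - x := by linarith [hx.2]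
    have e1 : 1 - (2 * x - 1) = 2 * (1 - x) := by ring
    have e2 : 1 + (2 * x - 1) = 2 * x := by ring
    simp only [jacobiWeight]
    rw [e1, e2, Real.mul_rpow (by norm_num) hx1, Real.mul_rpow (by norm_num) hx.1,
      Real.rpow_add (by norm_num)]
    ring
  rw [h4, h] at h3
  norm_num at h3
  rw [jacobiInt, ← integral_Ioc_eq_integral_Ioo, ← intervalIntegral.integral_of_le (by norm_num)]
  simp only [Polynomial.eval_one, mul_one]
  have e : b + 1 + (a + 1) = a + b + 2 := by ring
  rw [e] at h3
  rw [Real.rpow_add_one (by norm_num)]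
  linear_combination (-2) * h3

theorem jacobiInt_one_pos {a b : ℝ} (ha : -1 < a) (hb : -1 < b) : 0 < jacobiInt a b 1 := by
  rw [jacobiInt_one ha hb]
  have h1 := Real.Gamma_pos_of_pos (show 0 < a + 1 by linarith)
  have h2 := Real.Gamma_pos_of_pos (show 0 < b + 1 by linarith)
  have h3 := Real.Gamma_pos_of_pos (show 0 < a + b + 2 by linarith)
  positivity

/-- The derivative of `jacobiWeight (a + 1) (b + 1)` is the weight times `(b - a) - (a + b + 2) X`,
and its integral vanishes. -/
theorem jacobiInt_X {a b : ℝ} (ha : -1 < a) (hb : -1 < b) :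
    jacobiInt a b Polynomial.X = (b - a) / (a + b + 2) * jacobiInt a b 1 := by
  have h := jacobiInt_step (a := a + 1) (b := b + 1) (by linarith) (by linarith) 1
  rw [add_sub_cancel_right, add_sub_cancel_right] at h
  have e : jacobiStep (a + 1) (b + 1) 1 = Polynomial.C (b - a) * 1 +
      Polynomial.C (-(a + b + 2)) * Polynomial.X := by
    have h1 : b + 1 - (a + 1) = b - a := by ring
    have h2 : a + 1 + (b + 1) = a + b + 2 := by ring
    simp only [jacobiStep, h1, h2, Polynomial.C_neg, Polynomial.derivative_one]
    ring
  rw [e, jacobiInt_add ha hb, jacobiInt_C_mul, jacobiInt_C_mul] at h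
  have : a + b + 2 ≠ 0 := by linarith
  field_simp
  linarith

open Polynomial in
theorem jacobiInt_mul_jacobiPoly_of_natDegree_le {α β : ℝ} (hα : -1 < α) (hβ : -1 < β) {n : ℕ}
    {q : ℝ[X]} (hq : q.natDegree ≤ n) :
    jacobiInt α β (q * jacobiPoly α β n) =
      q.coeff n / 2 ^ n * jacobiInt (α + n) (β + n) 1 := by
  have e : derivative^[n] q = C (n.factorial * q.coeff n) * 1 := by
    have h0 : (derivative^[n] q).natDegree ≤ 0 :=
      (natDegree_iterate_derivative q n).trans (by omega)
    rw [eq_C_of_natDegree_le_zero h0, coeff_iterate_derivative]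
    simp [Nat.descFactorial_self]
  rw [jacobiInt_mul_jacobiPoly hα hβ, e, jacobiInt_C_mul]
  have : (n.factorial : ℝ) ≠ 0 := by exact_mod_cast n.factorial_ne_zero
  field_simp

open Polynomial in
theorem jacobiInt_mul_jacobiPoly_of_natDegree_lt {α β : ℝ} (hα : -1 < α) (hβ : -1 < β) {n : ℕ}
    {q : ℝ[X]} (hq : q.natDegree < n) : jacobiInt α β (q * jacobiPoly α β n) = 0 := by
  rw [jacobiInt_mul_jacobiPoly_of_natDegree_le hα hβ hq.le, coeff_eq_zero_of_natDegree_lt hq]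
  simp

-- With no term of degree `n`, the `n`-th derivative of `q` is a multiple of `X`, so the first
-- moment `jacobiInt_X` is what remains.
open Polynomial in
theorem jacobiInt_mul_jacobiPoly_of_natDegree_le_succ {α β : ℝ} (hα : -1 < α) (hβ : -1 < β)
    {n : ℕ} {q : ℝ[X]} (hq : q.natDegree ≤ n + 1) (hc : q.coeff n = 0) :
    jacobiInt α β (q * jacobiPoly α β n) = q.coeff (n + 1) * (n + 1) / 2 ^ n *
      ((β - α) / (2 * n + α + β + 2) * jacobiInt (α + n) (β + n) 1) := by
  have hn : (0 : ℝ) ≤ n := n.cast_nonneg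
  have e : derivative^[n] q = C ((n + 1).factorial * q.coeff (n + 1)) * X := by
    have h0 : (derivative^[n] q).natDegree ≤ 1 :=
      (natDegree_iterate_derivative q n).trans (by omega)
    rw [eq_X_add_C_of_natDegree_le_one h0, coeff_iterate_derivative, coeff_iterate_derivative]
    have h1 : (n + 1).descFactorial n = (n + 1).factorial := by
      have := Nat.factorial_mul_descFactorial (n := n + 1) (k := n) (by omega)
      simpa using this
    simp [h1, hc, add_comm 1 n]
  rw [jacobiInt_mul_jacobiPoly hα hβ, e, jacobiInt_C_mul,
    jacobiInt_X (by linarith) (by linarith), Nat.factorial_succ]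
  have : (n.factorial : ℝ) ≠ 0 := by exact_mod_cast n.factorial_ne_zero
  have e2 : α + n + (β + n) + 2 = 2 * n + α + β + 2 := by ring
  have e3 : β + n - (α + n) = β - α := by ring
  rw [e2, e3]
  push_cast
  field_simp

theorem jacobiGamma_pos {α β : ℝ} (hα : -1 < α) (hβ : -1 < β) (n : ℕ) : 0 < jacobiGamma α β n := by
  unfold jacobiGamma
  split_ifs with hn
  · have h1 := Real.Gamma_pos_of_pos (show 0 < α + 1 by linarith)
    have h2 := Real.Gamma_pos_of_pos (show 0 < β + 1 by linarith)
    have h3 := Real.Gamma_pos_of_pos (show 0 < α + β + 2 by linarith)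
    positivity
  · have hn1 : (1 : ℝ) ≤ n := by exact_mod_cast Nat.one_le_iff_ne_zero.2 hn
    have h1 := Real.Gamma_pos_of_pos (show 0 < n + α + 1 by linarith)
    have h2 := Real.Gamma_pos_of_pos (show 0 < n + β + 1 by linarith)
    have h3 := Real.Gamma_pos_of_pos (show 0 < n + α + β + 1 by linarith)
    have h4 : 0 < 2 * n + α + β + 1 := by linarith
    have : (0 : ℝ) < n.factorial := by exact_mod_cast n.factorial_pos
    positivity

theorem jacobiInt_one_eq_jacobiGamma_zero {α β : ℝ} (hα : -1 < α) (hβ : -1 < β) :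
    jacobiInt α β 1 = jacobiGamma α β 0 := by
  rw [jacobiInt_one hα hβ]
  simp [jacobiGamma]
  ring

theorem jacobiInt_jacobiPoly_sq {α β : ℝ} (hα : -1 < α) (hβ : -1 < β) (n : ℕ) :
    jacobiInt α β (jacobiPoly α β n * jacobiPoly α β n) = jacobiGamma α β n := by
  rw [jacobiInt_mul_jacobiPoly_of_natDegree_le hα hβ (natDegree_jacobiPoly_le α β n)]
  rcases eq_or_ne n 0 with rfl | hn
  · simp [jacobiPoly, jacobiRod, jacobiInt_one_eq_jacobiGamma_zero hα hβ]
  · have hn1 : (1 : ℝ) ≤ n := by exact_mod_cast Nat.one_le_iff_ne_zero.2 hn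
    rw [coeff_jacobiPoly hα hβ hn, jacobiInt_one (by linarith) (by linarith), jacobiGamma,
      if_neg hn]
    have h3 := Real.Gamma_pos_of_pos (show 0 < n + α + β + 1 by linarith)
    have h4 : 0 < 2 * n + α + β + 1 := by linarith
    have h5 := Real.Gamma_pos_of_pos h4
    have : (0 : ℝ) < n.factorial := by exact_mod_cast n.factorial_pos
    have e1 : α + n + (β + n) + 1 = (α + β + 1) + (2 * n : ℕ) := by push_cast; ring
    have e2 : α + n + (β + n) + 2 = (2 * n + α + β + 1) + 1 := by ring
    rw [e2, Real.Gamma_add_one h4.ne', e1, Real.rpow_add_natCast (by norm_num), pow_mul']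
    have e3 : α + n + 1 = n + α + 1 := by ring
    have e4 : β + n + 1 = n + β + 1 := by ring
    rw [e3, e4]
    field_simp

-- An instance of the parity of Chebyshev polynomials.
open Polynomial in
theorem coeff_chebyshev_T_succ (n : ℕ) : (Chebyshev.T ℝ ((n + 1 : ℕ) : ℤ)).coeff n = 0 := by
  induction n with
  | zero => simp
  | succ n ih =>
    have h := Chebyshev.T_add_two ℝ (n : ℤ)
    have e : (((n + 1 + 1 : ℕ) : ℤ)) = n + 2 := by push_cast; ring
    have e1 : (n : ℤ) + 1 = ((n + 1 : ℕ) : ℤ) := by push_cast; ring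
    rw [e, h, e1, mul_assoc, coeff_sub, coeff_ofNat_mul, coeff_X_mul, ih,
      coeff_eq_zero_of_natDegree_lt]
    · simp
    · rw [Chebyshev.natDegree_T]
      simp

open Polynomial in
theorem coeff_chebyshev_T_self (n : ℕ) : (Chebyshev.T ℝ (n : ℤ)).coeff n = 2 ^ (n - 1) := by
  have := Chebyshev.leadingCoeff_T ℝ (n : ℤ)
  rw [leadingCoeff, Chebyshev.natDegree_T] at this
  simpa using this

-- The leading coefficient `2 ^ (n - 1)` cancels `2 ^ n` up to the factor 2. This fails for `n = 0`,
-- where truncated subtraction gives the correct leading coefficient 1.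
open Polynomial in
theorem jacobiInt_chebyshev_self {α β : ℝ} (hα : -1 < α) (hβ : -1 < β) {n : ℕ} (hn : n ≠ 0) :
    2 * jacobiInt α β (Chebyshev.T ℝ (n : ℤ) * jacobiPoly α β n) =
      jacobiInt (α + n) (β + n) 1 := by
  rw [jacobiInt_mul_jacobiPoly_of_natDegree_le hα hβ (by simp [Chebyshev.natDegree_T]),
    coeff_chebyshev_T_self]
  obtain ⟨m, rfl⟩ := Nat.exists_eq_succ_of_ne_zero hn
  simp only [Nat.succ_eq_add_one, Nat.add_sub_cancel, pow_succ]
  field_simp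

open Polynomial in
theorem jacobiInt_chebyshev_succ {α β : ℝ} (hα : -1 < α) (hβ : -1 < β) (n : ℕ) :
    2 * jacobiInt α β (Chebyshev.T ℝ ((n + 1 : ℕ) : ℤ) * jacobiPoly α β n) =
      (β - α) * ((2 * n + 2) / (2 * n + α + β + 2)) * jacobiInt (α + n) (β + n) 1 := by
  rw [jacobiInt_mul_jacobiPoly_of_natDegree_le_succ hα hβ
    (by rw [Chebyshev.natDegree_T, Int.natAbs_natCast]) (coeff_chebyshev_T_succ n), coeff_chebyshev_T_self]
  simp only [Nat.add_sub_cancel]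
  field_simp

end Weight

/-! ### Asymptotics of Gamma quotients with error `O(1 / n)`. -/

section GammaRatio

open Filter Asymptotics

theorem isBigO_mul_sub_one {f g : ℕ → ℝ}
    (hf : (fun n => f n - 1) =O[atTop] (fun n : ℕ => 1 / (n : ℝ)))
    (hg : (fun n => g n - 1) =O[atTop] (fun n : ℕ => 1 / (n : ℝ))) :
    (fun n => f n * g n - 1) =O[atTop] (fun n : ℕ => 1 / (n : ℝ)) := by
  have h1 : (fun n => g n - 1) =O[atTop] (fun _ => (1 : ℝ)) :=
    hg.trans ((tendsto_one_div_atTop_nhds_zero_nat (𝕜 := ℝ)).isBigO_one ℝ)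
  have h2 := hf.mul h1
  simp only [mul_one] at h2
  refine ((h2.add hf).add hg).congr_left fun n => ?_
  ring

theorem isBigO_inv_sub_one {f : ℕ → ℝ}
    (hf : (fun n => f n - 1) =O[atTop] (fun n : ℕ => 1 / (n : ℝ))) :
    (fun n => (f n)⁻¹ - 1) =O[atTop] (fun n : ℕ => 1 / (n : ℝ)) := by
  have h0 : Tendsto f atTop (nhds 1) := by
    have := hf.trans_tendsto (tendsto_one_div_atTop_nhds_zero_nat (𝕜 := ℝ))
    simpa using this.add_const 1
  have h1 := (h0.inv₀ one_ne_zero).isBigO_one ℝ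
  have h2 := (hf.mul h1).neg_left
  simp only [mul_one] at h2
  refine h2.congr' ?_ EventuallyEq.rfl
  filter_upwards [h0.eventually_ne one_ne_zero] with n hn
  field_simp
  ring

theorem isBigO_one_add_div_sub_one (c : ℝ) :
    (fun n : ℕ => (1 + c / n) - 1) =O[atTop] (fun n : ℕ => 1 / (n : ℝ)) := by
  refine ((isBigO_refl (fun n : ℕ => 1 / (n : ℝ)) atTop).const_mul_left c).congr_left fun n => ?_
  ring

/-- The quotient `Γ(n + a) / (Γ(n) n ^ a)`. -/
noncomputable def gammaRatio (a : ℝ) (n : ℕ) : ℝ :=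
  Real.Gamma (n + a) / (Real.Gamma n * (n : ℝ) ^ a)

/-- Log-convexity of Gamma: interpolating `n + a` between `n` and `n + 1` gives the upper bound,
interpolating `n + 1` between `n + a` and `n + a + 1` the lower one. -/
theorem gammaRatio_mem_Icc {a : ℝ} (h0 : 0 < a) (h1 : a < 1) {n : ℕ} (hn : 1 ≤ n) :
    gammaRatio a n ∈ Set.Icc (1 - 1 / (n : ℝ)) 1 := by
  have hn0 : (0 : ℝ) < n := by exact_mod_cast hn
  have hG := Real.Gamma_pos_of_pos hn0
  have hGa := Real.Gamma_pos_of_pos (show 0 < n + a by linarith)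
  have hp := Real.rpow_pos_of_pos hn0 a
  constructor
  · have h := Real.Gamma_mul_add_mul_le_rpow_Gamma_mul_rpow_Gamma (s := n + a) (t := n + a + 1)
      (a := a) (b := 1 - a) (by linarith) (by linarith) h0 (by linarith) (by ring)
    have e : a * (n + a) + (1 - a) * (n + a + 1) = n + 1 := by ring
    rw [e, Real.Gamma_add_one hn0.ne', Real.Gamma_add_one (by linarith),
      Real.mul_rpow (by linarith) hGa.le, mul_left_comm, ← Real.rpow_add hGa,
      add_sub_cancel, Real.rpow_one] at h
    have h2 : ((n : ℝ) + a) ^ (1 - a) ≤ (n : ℝ) ^ (1 - a) * ((n + a) / n) := by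
      have e3 : (n : ℝ) + a = n * ((n + a) / n) := by field_simp
      have h3 : (1 : ℝ) ≤ (n + a) / n := by rw [le_div_iff₀ hn0]; linarith
      have h4 : ((n + a) / n : ℝ) ^ (1 - a) ≤ ((n + a) / n : ℝ) ^ (1 : ℝ) :=
        Real.rpow_le_rpow_of_exponent_le h3 (by linarith)
      rw [Real.rpow_one] at h4
      calc ((n : ℝ) + a) ^ (1 - a) = (n * ((n + a) / n) : ℝ) ^ (1 - a) := by rw [← e3]
        _ = (n : ℝ) ^ (1 - a) * ((n + a) / n : ℝ) ^ (1 - a) :=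
          Real.mul_rpow hn0.le (by linarith)
        _ ≤ _ := by gcongr
    have h5 : (n : ℝ) ^ (1 - a) = n / (n : ℝ) ^ a := by rw [Real.rpow_sub hn0, Real.rpow_one]
    have h6 : n * Real.Gamma n ≤ n / (n : ℝ) ^ a * ((n + a) / n) * Real.Gamma (n + a) := by
      rw [← h5]
      exact h.trans (mul_le_mul_of_nonneg_right h2 hGa.le)
    have h7 : (n : ℝ) / (n + a) ≤ gammaRatio a n := by
      unfold gammaRatio
      rw [div_le_div_iff₀ (by linarith) (by positivity)]
      have e8 : n / (n : ℝ) ^ a * ((n + a) / n) * Real.Gamma (n + a) =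
        (Real.Gamma (n + a) * (n + a)) / (n : ℝ) ^ a := by field_simp
      rw [e8, le_div_iff₀ hp] at h6
      linarith
    refine le_trans ?_ h7
    rw [le_div_iff₀ (by linarith)]
    have e9 : (1 - 1 / (n : ℝ)) * (n + a) = n + a - 1 - a / n := by field_simp; ring
    rw [e9]
    have : 0 < a / n := by positivity
    linarith
  · have h := Real.Gamma_mul_add_mul_le_rpow_Gamma_mul_rpow_Gamma (s := n) (t := n + 1)
      (a := 1 - a) (b := a) (by linarith) (by linarith) (by linarith) h0 (by ring)
    have e : (1 - a) * n + a * (n + 1) = n + a := by ring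
    rw [e, Real.Gamma_add_one hn0.ne', Real.mul_rpow hn0.le hG.le, mul_left_comm,
      ← Real.rpow_add hG, sub_add_cancel, Real.rpow_one] at h
    unfold gammaRatio
    rw [div_le_one (by positivity)]
    linarith

theorem gammaRatio_add_one {a : ℝ} {n : ℕ} (hn : 1 ≤ n) (ha : 0 < n + a) :
    gammaRatio (a + 1) n = gammaRatio a n * (1 + a / n) := by
  have hn0 : (0 : ℝ) < n := by exact_mod_cast hn
  unfold gammaRatio
  rw [← add_assoc, Real.Gamma_add_one ha.ne', Real.rpow_add_one hn0.ne']
  field_simp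

theorem eventually_pos_natCast_add (a : ℝ) : ∀ᶠ n : ℕ in atTop, 1 ≤ n ∧ 0 < (n : ℝ) + a := by
  filter_upwards [eventually_ge_atTop 1, eventually_gt_atTop ⌈-a⌉₊] with n h1 h2
  refine ⟨h1, ?_⟩
  have := Nat.lt_of_ceil_lt h2
  linarith

/-- Log-convexity settles the fractional part of `a`; the functional equation then shifts by
integers in both directions. -/
theorem gammaRatio_isBigO (a : ℝ) :
    (fun n => gammaRatio a n - 1) =O[atTop] (fun n : ℕ => 1 / (n : ℝ)) := by
  have base : (fun n => gammaRatio (Int.fract a) n - 1) =O[atTop] (fun n : ℕ => 1 / (n : ℝ)) := by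
    rcases (Int.fract_nonneg a).eq_or_lt with h | h
    · rw [← h]
      refine (isBigO_zero _ _).congr' ?_ EventuallyEq.rfl
      filter_upwards [eventually_ge_atTop 1] with n hn
      have := (Real.Gamma_pos_of_pos (show (0 : ℝ) < n by exact_mod_cast hn)).ne'
      simp [gammaRatio, this]
    · refine IsBigO.of_bound 1 ?_
      filter_upwards [eventually_ge_atTop 1] with n hn
      have hm := gammaRatio_mem_Icc h (Int.fract_lt_one a) hn
      have hp : (0 : ℝ) ≤ 1 / n := by positivity
      rw [Real.norm_eq_abs, Real.norm_eq_abs, abs_of_nonneg hp, abs_le]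
      constructor <;> linarith [hm.1, hm.2]
  have key : ∀ m : ℤ, (fun n => gammaRatio (Int.fract a + m) n - 1)
      =O[atTop] (fun n : ℕ => 1 / (n : ℝ)) := by
    intro m
    induction m using Int.induction_on with
    | zero => simpa using base
    | succ i ih =>
      refine (isBigO_mul_sub_one ih (isBigO_one_add_div_sub_one (Int.fract a + i))).congr' ?_
        EventuallyEq.rfl
      filter_upwards [eventually_pos_natCast_add (Int.fract a + i)] with n hn
      have := gammaRatio_add_one hn.1 hn.2
      push_cast
      rw [← add_assoc, this]
    | pred i ih =>
      refine (isBigO_mul_sub_one ih (isBigO_inv_sub_one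
        (isBigO_one_add_div_sub_one (Int.fract a + (-i - 1))))).congr' ?_ EventuallyEq.rfl
      filter_upwards [eventually_pos_natCast_add (Int.fract a + (-i - 1))] with n hn
      have h1 := gammaRatio_add_one hn.1 hn.2
      have hn0 : (0 : ℝ) < n := by exact_mod_cast hn.1
      have h2 : 1 + (Int.fract a + (-(i : ℝ) - 1)) / n ≠ 0 := by
        have : 1 + (Int.fract a + (-(i : ℝ) - 1)) / n = (n + (Int.fract a + (-i - 1))) / n := by
          field_simp
        rw [this]
        exact (div_pos hn.2 hn0).ne'
      have e : Int.fract a + (-(i : ℝ) - 1) + 1 = Int.fract a + -i := by ring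
      rw [e] at h1
      push_cast
      rw [h1, mul_assoc, mul_inv_cancel₀ h2, mul_one]
  have := key ⌊a⌋
  rwa [Int.fract_add_floor] at this

theorem Gamma_eq_gammaRatio_mul (a : ℝ) {n : ℕ} (hn : 1 ≤ n) :
    Real.Gamma (n + a) = gammaRatio a n * (Real.Gamma n * (n : ℝ) ^ a) := by
  have hn0 : (0 : ℝ) < n := by exact_mod_cast hn
  have := (Real.Gamma_pos_of_pos hn0).ne'
  have := (Real.rpow_pos_of_pos hn0 a).ne'
  unfold gammaRatio
  field_simp

/-- Legendre duplication splits `Γ(2n + α + β + 2)` into two Gamma values near `n`. All powers of 2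
but `2 ^ (α + β)` cancel, and everything else is a product of factors `1 + O(1 / n)`. -/
theorem jacobiInt_sq_div_jacobiGamma {α β : ℝ} (hα : -1 < α) (hβ : -1 < β) {n : ℕ} (hn : 1 ≤ n) :
    jacobiInt (α + n) (β + n) 1 ^ 2 / jacobiGamma α β n = Real.pi / 2 ^ (α + β) *
      (gammaRatio (α + 1) n * gammaRatio (β + 1) n * gammaRatio 1 n * gammaRatio (α + β + 1) n *
        (1 + ((α + β + 1) / 2) / n) * (gammaRatio ((α + β) / 2 + 1) n *
          gammaRatio ((α + β) / 2 + 3 / 2) n * (gammaRatio ((α + β) / 2 + 1) n *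
          gammaRatio ((α + β) / 2 + 3 / 2) n))⁻¹) := by
  have hn1 : (1 : ℝ) ≤ n := by exact_mod_cast hn
  have hn0 : (0 : ℝ) < n := by linarith
  have hG := Real.Gamma_pos_of_pos hn0
  have d := Real.Gamma_mul_Gamma_add_half (n + ((α + β) / 2 + 1))
  have e0 : (n : ℝ) + ((α + β) / 2 + 1) + 1 / 2 = n + ((α + β) / 2 + 3 / 2) := by ring
  have e1 : 2 * ((n : ℝ) + ((α + β) / 2 + 1)) = 2 * n + α + β + 2 := by ring
  have e2 : 1 - (2 * (n : ℝ) + α + β + 2) = -((α + β + 1) + (2 * n : ℕ)) := by push_cast; ring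
  rw [e0, e1, e2, Real.rpow_neg (by norm_num), Real.rpow_add_natCast (by norm_num)] at d
  have p1 := Real.Gamma_pos_of_pos (show 0 < n + ((α + β) / 2 + 1) by linarith)
  have p2 := Real.Gamma_pos_of_pos (show 0 < n + ((α + β) / 2 + 3 / 2) by linarith)
  have p3 := Real.Gamma_pos_of_pos (show 0 < 2 * n + α + β + 2 by linarith)
  have p4 := Real.Gamma_pos_of_pos (show 0 < n + (α + 1) by linarith)
  have p5 := Real.Gamma_pos_of_pos (show 0 < n + (β + 1) by linarith)
  have p6 := Real.Gamma_pos_of_pos (show 0 < n + (α + β + 1) by linarith)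
  have p7 : 0 < 2 * n + α + β + 1 := by linarith
  have pf : (0 : ℝ) < n.factorial := by exact_mod_cast n.factorial_pos
  have t1 : (0 : ℝ) < 2 ^ (α + β) := by positivity
  have t2 : (2 : ℝ) ^ (α + β + 1) = 2 ^ (α + β) * 2 := Real.rpow_add_one (by norm_num) _
  have hR : jacobiInt (α + n) (β + n) 1 ^ 2 / jacobiGamma α β n = Real.pi / 2 ^ (α + β) *
      (Real.Gamma (n + (α + 1)) * Real.Gamma (n + (β + 1)) * n.factorial *
        Real.Gamma (n + (α + β + 1)) * ((2 * n + α + β + 1) / 2) /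
        (Real.Gamma (n + ((α + β) / 2 + 1)) * Real.Gamma (n + ((α + β) / 2 + 3 / 2))) ^ 2) := by
    rw [d, jacobiInt_one (by linarith) (by linarith), jacobiGamma, if_neg (by omega)]
    have e3 : α + n + (β + n) + 1 = (α + β + 1) + (2 * n : ℕ) := by push_cast; ring
    have e4 : α + n + (β + n) + 2 = 2 * n + α + β + 2 := by ring
    have e5 : α + n + 1 = n + (α + 1) := by ring
    have e6 : β + n + 1 = n + (β + 1) := by ring
    have e7 : n + α + β + 1 = n + (α + β + 1) := by ring
    rw [e4, e3, e5, e6, e7, Real.rpow_add_natCast (by norm_num), t2, ← add_assoc, ← add_assoc]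
    have ep : Real.sqrt Real.pi ^ 2 = Real.pi := Real.sq_sqrt Real.pi_pos.le
    rw [add_assoc, add_assoc]
    simp only [mul_pow, div_pow, inv_pow, ep]
    field_simp
  have ef : (n.factorial : ℝ) = Real.Gamma (n + 1) := (Real.Gamma_nat_eq_factorial n).symm
  rw [hR, ef]
  congr 1
  -- Both sides are `n ^ (2 (α + β) + 5)`, so no power of `n` survives in the quotient.
  have hpow : (n : ℝ) ^ (α + 1) * (n : ℝ) ^ (β + 1) * (n : ℝ) ^ (1 : ℝ) * (n : ℝ) ^ (α + β + 1) *
      n = ((n : ℝ) ^ ((α + β) / 2 + 1) * (n : ℝ) ^ ((α + β) / 2 + 3 / 2)) ^ 2 := by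
    rw [← Real.rpow_add hn0, ← Real.rpow_add hn0, ← Real.rpow_add hn0, ← Real.rpow_add hn0,
      ← Real.rpow_add_one hn0.ne', ← Real.rpow_natCast, ← Real.rpow_mul hn0.le]
    congr 1
    push_cast
    ring
  have q1 : 0 < gammaRatio ((α + β) / 2 + 1) n := by unfold gammaRatio; positivity
  have q2 : 0 < gammaRatio ((α + β) / 2 + 3 / 2) n := by unfold gammaRatio; positivity
  rw [Gamma_eq_gammaRatio_mul (α + 1) hn, Gamma_eq_gammaRatio_mul (β + 1) hn,
    Gamma_eq_gammaRatio_mul 1 hn, Gamma_eq_gammaRatio_mul (α + β + 1) hn,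
    Gamma_eq_gammaRatio_mul ((α + β) / 2 + 1) hn,
    Gamma_eq_gammaRatio_mul ((α + β) / 2 + 3 / 2) hn]
  have hx := Real.rpow_pos_of_pos hn0 ((α + β) / 2 + 1)
  have hy := Real.rpow_pos_of_pos hn0 ((α + β) / 2 + 3 / 2)
  generalize (n : ℝ) ^ ((α + β) / 2 + 1) = Y1 at *
  generalize (n : ℝ) ^ ((α + β) / 2 + 3 / 2) = Y2 at *
  generalize (n : ℝ) ^ (α + 1) = X1 at *
  generalize (n : ℝ) ^ (β + 1) = X2 at *
  generalize (n : ℝ) ^ (1 : ℝ) = X3 at *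
  generalize (n : ℝ) ^ (α + β + 1) = X4 at *
  have e8 : (2 * n + α + β + 1) / 2 = n * (1 + (α + β + 1) / 2 / n) := by field_simp; ring
  rw [e8, div_eq_iff (by positivity)]
  generalize 1 + (α + β + 1) / 2 / (n : ℝ) = W
  set r1 := gammaRatio ((α + β) / 2 + 1) n
  set r2 := gammaRatio ((α + β) / 2 + 3 / 2) n
  have e9 : (r1 * r2 * (r1 * r2))⁻¹ * (r1 * (Real.Gamma n * Y1) * (r2 * (Real.Gamma n * Y2))) ^ 2 =
      Real.Gamma n ^ 4 * (Y1 * Y2) ^ 2 := by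
    field_simp
  rw [mul_assoc _ (_⁻¹), e9, ← hpow]
  ring

theorem exists_forall_le_one_add_div {f : ℕ → ℝ}
    (hf : (fun n => f n - 1) =O[atTop] (fun n : ℕ => 1 / (n : ℝ))) :
    ∃ K : ℝ, 0 ≤ K ∧ ∀ n : ℕ, 1 ≤ n → f n ≤ 1 + K / n := by
  obtain ⟨K, hK, h⟩ := bound_of_isBigO_nat_atTop hf
  refine ⟨K, hK.le, fun n hn => ?_⟩
  have hn0 : (0 : ℝ) < n := by exact_mod_cast hn
  have := h (x := n) (by positivity)
  rw [Real.norm_eq_abs, Real.norm_eq_abs, abs_of_pos (by positivity : (0 : ℝ) < 1 / n)] at this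
  have h2 := (le_abs_self _).trans this
  rw [div_eq_mul_one_div]
  linarith

theorem exists_jacobiInt_le {α β : ℝ} (hα : -1 < α) (hβ : -1 < β) :
    ∃ K : ℝ, 0 ≤ K ∧ ∀ n : ℕ, 1 ≤ n →
      jacobiInt (α + n) (β + n) 1 / Real.sqrt (jacobiGamma α β n) ≤
        Real.sqrt (Real.pi / 2 ^ (α + β)) * (1 + K / n) ∧
      (2 * n + 2) / (2 * n + α + β + 2) *
        (jacobiInt (α + n) (β + n) 1 / Real.sqrt (jacobiGamma α β n)) ≤
        Real.sqrt (Real.pi / 2 ^ (α + β)) * (1 + K / n) := by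
  set c := Real.pi / (2 : ℝ) ^ (α + β) with hc
  have hc0 : 0 < c := by positivity
  set Q : ℕ → ℝ := fun n => gammaRatio (α + 1) n * gammaRatio (β + 1) n * gammaRatio 1 n *
    gammaRatio (α + β + 1) n * (1 + ((α + β + 1) / 2) / n) * (gammaRatio ((α + β) / 2 + 1) n *
      gammaRatio ((α + β) / 2 + 3 / 2) n * (gammaRatio ((α + β) / 2 + 1) n *
      gammaRatio ((α + β) / 2 + 3 / 2) n))⁻¹ with hQ
  -- The extra factor `(2n + 2) / (2n + α + β + 2)` from `T_{n+1}`, in a form that is visibly `1 +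
  -- O(1 / n)`.
  set E : ℕ → ℝ := fun n => (1 + 1 / (n : ℝ)) * (1 + ((α + β) / 2 + 1) / n)⁻¹ with hE
  have hQO : (fun n => Q n - 1) =O[atTop] (fun n : ℕ => 1 / (n : ℝ)) := by
    have h1 := isBigO_mul_sub_one (gammaRatio_isBigO ((α + β) / 2 + 1))
      (gammaRatio_isBigO ((α + β) / 2 + 3 / 2))
    exact isBigO_mul_sub_one (isBigO_mul_sub_one (isBigO_mul_sub_one (isBigO_mul_sub_one
      (isBigO_mul_sub_one (gammaRatio_isBigO _) (gammaRatio_isBigO _)) (gammaRatio_isBigO _))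
      (gammaRatio_isBigO _)) (isBigO_one_add_div_sub_one _))
      (isBigO_inv_sub_one (isBigO_mul_sub_one h1 h1))
  have hEO : (fun n => E n - 1) =O[atTop] (fun n : ℕ => 1 / (n : ℝ)) :=
    isBigO_mul_sub_one (isBigO_one_add_div_sub_one _)
      (isBigO_inv_sub_one (isBigO_one_add_div_sub_one _))
  obtain ⟨K1, hK1, h1⟩ := exists_forall_le_one_add_div hQO
  obtain ⟨K2, hK2, h2⟩ := exists_forall_le_one_add_div
    (isBigO_mul_sub_one (isBigO_mul_sub_one hEO hEO) hQO)
  -- The square root costs nothing, since `1 + x ≤ (1 + x) ^ 2` for `x ≥ 0`; the sum `K1 + K2`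
  -- serves both estimates.
  have sqrt_bound : ∀ {x y K : ℝ} {n : ℕ}, 0 ≤ K → K ≤ K1 + K2 → x ^ 2 = c * y →
      y ≤ 1 + K / n → x ≤ Real.sqrt c * (1 + (K1 + K2) / n) := by
    intro x y K n hK hKK hxy hy
    have hn : (0 : ℝ) ≤ n := n.cast_nonneg
    have hd : K / n ≤ (K1 + K2) / n := by gcongr
    have hd0 : 0 ≤ K / n := by positivity
    refine le_of_sq_le_sq ?_ (by positivity)
    rw [mul_pow, Real.sq_sqrt hc0.le, hxy]
    gcongr
    nlinarith
  refine ⟨K1 + K2, by positivity, fun n hn => ?_⟩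
  have hn1 : (1 : ℝ) ≤ n := by exact_mod_cast hn
  have hB : (jacobiInt (α + n) (β + n) 1 / Real.sqrt (jacobiGamma α β n)) ^ 2 = c * Q n := by
    rw [div_pow, Real.sq_sqrt (jacobiGamma_pos hα hβ n).le]
    exact jacobiInt_sq_div_jacobiGamma hα hβ hn
  have hEn : (2 * n + 2) / (2 * n + α + β + 2) = E n := by
    have : 1 + ((α + β) / 2 + 1) / (n : ℝ) = (2 * n + α + β + 2) / (2 * n) := by field_simp; ring
    have h3 : 2 * n + α + β + 2 ≠ 0 := by linarith
    rw [hE]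
    simp only
    rw [this]
    field_simp
  refine ⟨sqrt_bound hK1 (by linarith) hB (h1 n hn), sqrt_bound hK2 (by linarith) ?_ (h2 n hn)⟩
  rw [hEn, mul_pow, hB]
  ring

end GammaRatio

/-! ### Chebyshev expansion of functions analytic in a Bernstein ellipse. -/

section Chebyshev

open Complex Real Polynomial

/-- Needed because `sSup` of an unbounded set is 0 and would bound nothing. -/
theorem isBounded_bernsteinImage {ρ : ℝ} {u : ℂ → ℂ} (h : ContinuousOn u (bernsteinEllipse ρ))
    (hρ : ρ ≠ 0) : BddAbove ((fun z => ‖u z‖) '' bernsteinEllipse ρ) := by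
  have e : bernsteinEllipse ρ = (fun θ : ℝ => ((ρ : ℂ) * Complex.exp (Complex.I * (θ : ℂ)) +
      ((ρ : ℂ) * Complex.exp (Complex.I * (θ : ℂ)))⁻¹) / 2) '' Set.Icc (0 : ℝ) (2 * Real.pi) := by
    ext z
    constructor
    · rintro ⟨θ, hθ, w, rfl, rfl⟩
      exact ⟨θ, hθ, rfl⟩
    · rintro ⟨θ, hθ, rfl⟩
      exact ⟨θ, hθ, _, rfl, rfl⟩
  have hc : IsCompact (bernsteinEllipse ρ) := by
    rw [e]
    refine isCompact_Icc.image ?_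
    have h1 : Continuous fun θ : ℝ => (ρ : ℂ) * Complex.exp (Complex.I * (θ : ℂ)) := by fun_prop
    have h2 : ∀ θ : ℝ, (ρ : ℂ) * Complex.exp (Complex.I * (θ : ℂ)) ≠ 0 := fun θ =>
      mul_ne_zero (by exact_mod_cast hρ) (Complex.exp_ne_zero _)
    exact (h1.add (h1.inv₀ h2)).div_const 2
  exact (hc.image_of_continuousOn h.norm).bddAbove

/-- The circle of radius `r` goes to the ellipse with semi-axes `(r ± r⁻¹) / 2`, and these increase
with `r ≥ 1`. -/
theorem joukowski_mem_bernsteinRegion {ρ : ℝ} (hρ : 1 < ρ) {w : ℂ} (h1 : 1 ≤ ‖w‖) (h2 : ‖w‖ ≤ ρ) :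
    (w + w⁻¹) / 2 ∈ bernsteinRegion ρ := by
  set r := ‖w‖ with hr
  have hr0 : 0 < r := by linarith
  have hn : normSq w = r ^ 2 := by rw [normSq_eq_norm_sq]
  have hsq : w.re ^ 2 + w.im ^ 2 = r ^ 2 := by
    rw [← hn, normSq_apply]; ring
  have ere : ((w + w⁻¹) / 2).re = w.re / r * ((r + r⁻¹) / 2) := by
    have : ((w + w⁻¹) / 2).re = (w.re + w.re / r ^ 2) / 2 := by
      rw [show (2 : ℂ) = ((2 : ℝ) : ℂ) by norm_num, div_ofReal_re, add_re, inv_re, hn]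
    rw [this]
    field_simp
  have eim : ((w + w⁻¹) / 2).im = w.im / r * ((r - r⁻¹) / 2) := by
    have : ((w + w⁻¹) / 2).im = (w.im - w.im / r ^ 2) / 2 := by
      rw [show (2 : ℂ) = ((2 : ℝ) : ℂ) by norm_num, div_ofReal_im, add_im, inv_im, hn]
      ring
    rw [this]
    field_simp
  have hinv : ρ⁻¹ ≤ r⁻¹ := inv_anti₀ hr0 h2
  have hr1 : r⁻¹ ≤ 1 := inv_le_one_of_one_le₀ h1
  have hρ1 : ρ⁻¹ < 1 := inv_lt_one_of_one_lt₀ hρ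
  have hρ0 : 0 < ρ⁻¹ := by positivity
  have ha : ((r + r⁻¹) / 2) / ((ρ + ρ⁻¹) / 2) ≤ 1 := by
    rw [div_le_one (by positivity)]
    have : (ρ - r) * (1 - ρ⁻¹ * r⁻¹) ≥ 0 := by
      refine mul_nonneg (by linarith) ?_
      nlinarith
    have e3 : (ρ - r) * (1 - ρ⁻¹ * r⁻¹) = ρ + ρ⁻¹ - (r + r⁻¹) := by field_simp; ring
    linarith
  have hb : ((r - r⁻¹) / 2) / ((ρ - ρ⁻¹) / 2) ≤ 1 := by
    rw [div_le_one (by linarith)]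
    linarith
  have ha0 : 0 ≤ ((r + r⁻¹) / 2) / ((ρ + ρ⁻¹) / 2) := by positivity
  have hb0 : 0 ≤ ((r - r⁻¹) / 2) / ((ρ - ρ⁻¹) / 2) := div_nonneg (by linarith) (by linarith)
  change (((w + w⁻¹) / 2).re / ((ρ + ρ⁻¹) / 2)) ^ 2 + (((w + w⁻¹) / 2).im / ((ρ - ρ⁻¹) / 2)) ^ 2 ≤ 1
  rw [ere, eim, mul_div_assoc, mul_div_assoc, mul_pow, mul_pow]
  have h3 : (w.re / r) ^ 2 + (w.im / r) ^ 2 = 1 := by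
    rw [div_pow, div_pow, ← add_div, hsq, div_self (by positivity)]
  calc _ ≤ (w.re / r) ^ 2 * 1 + (w.im / r) ^ 2 * 1 := by
        gcongr
        · exact pow_le_one₀ ha0 ha
        · exact pow_le_one₀ hb0 hb
    _ = 1 := by rw [mul_one, mul_one, h3]

theorem joukowski_mem_bernsteinEllipse {ρ : ℝ} (hρ : 0 < ρ) {w : ℂ} (h : ‖w‖ = ρ) :
    (w + w⁻¹) / 2 ∈ bernsteinEllipse ρ := by
  have hw : w ∈ Metric.sphere (0 : ℂ) |ρ| := by simp [h, abs_of_pos hρ]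
  rw [← image_circleMap_Ioc] at hw
  obtain ⟨θ, hθ, rfl⟩ := hw
  refine ⟨θ, ⟨hθ.1.le, hθ.2⟩, _, ?_, rfl⟩
  simp [circleMap, mul_comm]

theorem norm_le_bernsteinMax {ρ : ℝ} (hρ : 1 < ρ) {u : ℂ → ℂ} (hu : u ∈ bernsteinAnalytic ρ)
    {w : ℂ} (h : ‖w‖ = ρ) : ‖u ((w + w⁻¹) / 2)‖ ≤ bernsteinMax ρ u := by
  refine le_csSup (isBounded_bernsteinImage ?_ (by linarith))
    ⟨_, joukowski_mem_bernsteinEllipse (by linarith) h, rfl⟩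
  have hs : bernsteinEllipse ρ ⊆ bernsteinRegion ρ := by
    rintro z ⟨θ, hθ, w, hw, rfl⟩
    have : ‖w‖ = ρ := by
      rw [hw, mul_comm Complex.I, norm_mul, Complex.norm_exp_ofReal_mul_I, mul_one]
      simp [abs_of_pos (by linarith : 0 < ρ)]
    exact joukowski_mem_bernsteinRegion hρ (by linarith) this.le
  exact (AnalyticOnNhd.continuousOn hu).mono hs

/-- The Laurent coefficients of `u ((w + w⁻¹) / 2)`. -/
noncomputable def joukowskiCoeff (u : ℂ → ℂ) (n : ℤ) : ℂ :=
  (2 * π * I : ℂ)⁻¹ • ∮ w in C(0, 1), u ((w + w⁻¹) / 2) * w ^ (-n - 1)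

/-- Cauchy's theorem on the annulus `1 ≤ |w| ≤ ρ` moves the contour to the outer circle. -/
theorem norm_joukowskiCoeff_le {ρ : ℝ} (hρ : 1 < ρ) {u : ℂ → ℂ} (hu : u ∈ bernsteinAnalytic ρ)
    (n : ℤ) : ‖joukowskiCoeff u n‖ ≤ bernsteinMax ρ u * ρ ^ (-n) := by
  have hρ0 : 0 < ρ := by linarith
  have hdiff : ∀ w : ℂ, 1 ≤ ‖w‖ → ‖w‖ ≤ ρ →
      DifferentiableAt ℂ (fun w : ℂ => u ((w + w⁻¹) / 2) * w ^ (-n - 1)) w := by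
    intro w h1 h2
    have hw : w ≠ 0 := norm_pos_iff.1 (by linarith)
    have d1 : DifferentiableAt ℂ (fun w : ℂ => (w + w⁻¹) / 2) w :=
      (differentiableAt_id.add (differentiableAt_id.inv hw)).div_const 2
    have d2 : DifferentiableAt ℂ u ((w + w⁻¹) / 2) :=
      (hu _ (joukowski_mem_bernsteinRegion hρ h1 h2)).differentiableAt
    exact (d2.comp w d1).mul (differentiableAt_zpow.2 (Or.inl hw))
  have key := circleIntegral_eq_of_differentiable_on_annulus_off_countable (c := 0) (r := 1)
    (R := ρ) one_pos hρ.le (f := fun w : ℂ => u ((w + w⁻¹) / 2) * w ^ (-n - 1))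
    Set.countable_empty ?_ ?_
  · rw [joukowskiCoeff, ← key]
    refine (circleIntegral.norm_two_pi_i_inv_smul_integral_le_of_norm_le_const hρ0.le
      (C := bernsteinMax ρ u * ρ ^ (-n - 1)) fun w hw => ?_).trans_eq ?_
    · have hw' : ‖w‖ = ρ := by simpa using hw
      rw [norm_mul, norm_zpow, hw']
      gcongr
      exact norm_le_bernsteinMax hρ hu hw'
    · rw [zpow_sub_one₀ hρ0.ne']
      field_simp
  · intro w hw
    have hw1 : ‖w‖ ≤ ρ := by simpa using hw.1
    have hw2 : 1 ≤ ‖w‖ := by simpa using hw.2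
    exact (hdiff w hw2 hw1).continuousAt.continuousWithinAt
  · intro w hw
    have hw1 : ‖w‖ < ρ := by simpa using hw.1.1
    have hw2 : 1 < ‖w‖ := by simpa using hw.1.2
    exact hdiff w hw2.le hw1.le

/-- The Joukowski map is invariant under `w ↦ w⁻¹`, that is, `θ ↦ 2π - θ`. -/
theorem joukowskiCoeff_neg (u : ℂ → ℂ) (n : ℤ) : joukowskiCoeff u (-n) = joukowskiCoeff u n := by
  unfold joukowskiCoeff circleIntegral
  congr 1
  have h1 := intervalIntegral.integral_comp_sub_left (a := 0) (b := 2 * π)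
    (fun θ : ℝ => deriv (circleMap 0 1) θ •
      (u ((circleMap 0 1 θ + (circleMap 0 1 θ)⁻¹) / 2) * circleMap 0 1 θ ^ (-n - 1))) (2 * π)
  rw [sub_self, sub_zero] at h1
  rw [← h1]
  refine intervalIntegral.integral_congr fun θ _ => ?_
  have e : circleMap 0 1 (2 * π - θ) = (circleMap 0 1 θ)⁻¹ := by
    rw [circleMap_zero_inv, inv_one, ← periodic_circleMap 0 1 (-θ), ← sub_eq_neg_add]
  have hz : circleMap 0 1 θ ≠ 0 := circleMap_ne_center one_ne_zero
  simp only [deriv_circleMap, e, inv_inv, smul_eq_mul]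
  rw [add_comm (circleMap 0 1 θ)⁻¹, inv_zpow', zpow_sub₀ hz, neg_sub, neg_neg, zpow_sub₀ hz,
    zpow_neg]
  simp only [zpow_one]
  field_simp

instance : Fact (0 < 2 * π) := ⟨Real.two_pi_pos⟩

/-- The coefficients are the Fourier coefficients of `u (cos θ)`; being summable, they give
pointwise convergence. -/
theorem hasSum_joukowskiCoeff {ρ : ℝ} (hρ : 1 < ρ) {u : ℂ → ℂ} (hu : u ∈ bernsteinAnalytic ρ)
    (θ : ℝ) : HasSum (fun n : ℤ => joukowskiCoeff u n * Complex.exp (n * θ * I))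
      (u (Real.cos θ : ℝ)) := by
  have hcont : Continuous fun t : AddCircle (2 * π) =>
      u (((AddCircle.toCircle t : ℂ) + (AddCircle.toCircle t : ℂ)⁻¹) / 2) := by
    rw [continuous_iff_continuousAt]
    intro t
    have hc : ContinuousAt (fun t : AddCircle (2 * π) => (AddCircle.toCircle t : ℂ)) t := by
      have := AddCircle.continuous_toCircle (T := 2 * π)
      fun_prop
    refine ContinuousAt.comp (f := fun t : AddCircle (2 * π) =>
      ((AddCircle.toCircle t : ℂ) + (AddCircle.toCircle t : ℂ)⁻¹) / 2) (g := u) ?_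
      ((hc.add (hc.inv₀ (Circle.coe_ne_zero _))).div_const 2)
    exact (hu _ (joukowski_mem_bernsteinRegion hρ (Circle.norm_coe _).ge
      ((Circle.norm_coe _).trans_le hρ.le))).continuousAt
  let f : C(AddCircle (2 * π), ℂ) := ⟨_, hcont⟩
  have hcoe : ∀ x : ℝ, (AddCircle.toCircle (x : AddCircle (2 * π)) : ℂ) = circleMap 0 1 x := by
    intro x
    rw [AddCircle.toCircle_apply_mk, div_self Real.two_pi_pos.ne', one_mul, Circle.coe_exp]
    simp [circleMap]
  have hf : ∀ x : ℝ, f (x : AddCircle (2 * π)) =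
      u ((circleMap 0 1 x + (circleMap 0 1 x)⁻¹) / 2) := by
    intro x
    rw [← hcoe x]
    rfl
  have hfour : ∀ (n : ℤ) (x : ℝ), fourier n (x : AddCircle (2 * π)) = circleMap 0 1 x ^ n := by
    intro n x
    rw [fourier_apply, AddCircle.toCircle_zsmul, Circle.coe_zpow, hcoe]
  have hcoeff : ∀ n : ℤ, fourierCoeff f n = joukowskiCoeff u n := by
    intro n
    rw [fourierCoeff_eq_intervalIntegral f n 0, joukowskiCoeff, circleIntegral, zero_add,
      ← intervalIntegral.integral_smul, ← intervalIntegral.integral_smul]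
    refine intervalIntegral.integral_congr fun x _ => ?_
    have hz : circleMap 0 1 x ≠ 0 := circleMap_ne_center one_ne_zero
    simp only [hf, hfour, deriv_circleMap, smul_eq_mul]
    rw [Complex.real_smul, zpow_sub₀ hz, zpow_one]
    push_cast
    field_simp
  have hsum : Summable (fourierCoeff f) := by
    have hg : Summable fun n : ℕ => bernsteinMax ρ u * (ρ⁻¹) ^ n :=
      (summable_geometric_of_lt_one (by positivity) (inv_lt_one_of_one_lt₀ hρ)).mul_left _
    have hb : ∀ n : ℕ, ‖fourierCoeff f (n : ℤ)‖ ≤ bernsteinMax ρ u * (ρ⁻¹) ^ n := by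
      intro n
      rw [hcoeff]
      refine (norm_joukowskiCoeff_le hρ hu n).trans_eq ?_
      rw [zpow_neg, zpow_natCast, inv_pow]
    refine Summable.of_nat_of_neg (Summable.of_norm_bounded hg hb)
      (Summable.of_norm_bounded hg fun n => ?_)
    -- The contour bound grows at negative indices; symmetry replaces it there.
    rw [hcoeff, joukowskiCoeff_neg, ← hcoeff]
    exact hb n
  have hx := has_pointwise_sum_fourier_series_of_summable hsum (θ : AddCircle (2 * π))
  rw [hf] at hx
  have e1 : (circleMap 0 1 θ + (circleMap 0 1 θ)⁻¹) / 2 = (Real.cos θ : ℝ) := by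
    rw [Complex.ofReal_cos, Complex.cos, circleMap]
    simp [← Complex.exp_neg]
  rw [e1] at hx
  refine hx.congr_fun fun n => ?_
  rw [hcoeff, hfour, smul_eq_mul, circleMap]
  simp [← Complex.exp_int_mul, mul_assoc]

theorem exists_chebyshev_expansion {ρ : ℝ} (hρ : 1 < ρ) {u : ℂ → ℂ}
    (hu : u ∈ bernsteinAnalytic ρ) :
    ∃ b : ℕ → ℂ, (∀ k, ‖b k‖ ≤ 2 * bernsteinMax ρ u * (ρ⁻¹) ^ k) ∧
      ∀ x ∈ Set.Icc (-1 : ℝ) 1,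
        HasSum (fun k : ℕ => b k * ((Chebyshev.T ℝ (k : ℤ)).eval x : ℝ)) (u x) := by
  refine ⟨fun k => if k = 0 then joukowskiCoeff u 0 else 2 * joukowskiCoeff u k, fun k => ?_,
    fun x hx => ?_⟩
  · have h := norm_joukowskiCoeff_le hρ hu k
    have hM : 0 ≤ bernsteinMax ρ u * ρ ^ (-(k : ℤ)) := (norm_nonneg _).trans h
    rw [zpow_neg, zpow_natCast, ← inv_pow] at h hM
    rw [mul_assoc]
    simp only
    split_ifs with hk
    · subst hk
      simp only [CharP.cast_eq_zero] at h
      linarith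
    · rw [norm_mul]
      simpa using h
  · have h := (hasSum_joukowskiCoeff hρ hu (Real.arccos x)).nat_add_neg
    rw [Real.cos_arccos hx.1 hx.2] at h
    -- Pairing `n` with `-n` counts the index 0 twice; one copy is removed.
    have h2 := h.sub (hasSum_ite_eq (0 : ℕ) (joukowskiCoeff u 0))
    simp only [Int.cast_zero, zero_mul, Complex.exp_zero, mul_one, add_sub_cancel_right] at h2
    refine h2.congr_fun fun k => ?_
    have hT : (((Chebyshev.T ℝ (k : ℤ)).eval x : ℝ) : ℂ) =
        (Complex.exp (k * Real.arccos x * I) + Complex.exp (-(k * Real.arccos x) * I)) / 2 := by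
      have := Chebyshev.T_real_cos (Real.arccos x) k
      rw [Real.cos_arccos hx.1 hx.2] at this
      rw [this, Complex.ofReal_cos, Complex.cos]
      push_cast
      rfl
    simp only [hT, joukowskiCoeff_neg]
    by_cases hk : k = 0
    · subst hk
      simp
    · rw [if_neg hk, if_neg hk]
      push_cast
      simp only [neg_mul]
      ring

end Chebyshev

/-! ### Truncation error of an orthonormal expansion. -/

section Hilbert

open Filter Topology

/-- As `T k` involves only `e 0, …, e k`, partial sums of the series for `u` are finite combinations
of the `e n` with explicit coefficients. The hypothesis is uniform in `m`, so the bound is proved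
for partial sums and passes to the limit by continuity of `P`. -/
theorem Orthonormal.norm_sub_sum_inner_le {E : Type*} [NormedAddCommGroup E]
    [InnerProductSpace ℂ E] {e T : ℕ → E} (he : Orthonormal ℂ e) {t : ℕ → ℕ → ℂ} {b : ℕ → ℂ}
    {u : E} (hT : ∀ k, T k = ∑ n ∈ Finset.range (k + 1), t n k • e n)
    (hu : Tendsto (fun m => ∑ k ∈ Finset.range m, b k • T k) atTop (𝓝 u)) {N : ℕ} {r A : ℝ}
    (hr0 : 0 ≤ r) (hr1 : r < 1) (hA0 : 0 ≤ A)
    (hA : ∀ n, N ≤ n → ∀ m, ‖∑ k ∈ Finset.Ico n m, b k * t n k‖ ≤ A * r ^ n) :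
    ‖u - ∑ n ∈ Finset.range N, inner ℂ (e n) u • e n‖ ≤ A * r ^ N / Real.sqrt (1 - r ^ 2) := by
  set P : E → E := fun v => v - ∑ n ∈ Finset.range N, inner ℂ (e n) v • e n with hP
  have hPc : Continuous P := by
    refine continuous_id.sub (continuous_finsetSum _ fun n _ => ?_)
    exact (continuous_const.inner continuous_id).smul continuous_const
  have hr2 : 0 < 1 - r ^ 2 := by nlinarith
  have hlim := ((hPc.tendsto u).comp hu).norm
  refine le_of_tendsto hlim ?_
  filter_upwards [eventually_ge_atTop N] with m hm
  set c : ℕ → ℂ := fun n => ∑ k ∈ Finset.Ico n m, b k * t n k with hc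
  have hS : ∑ k ∈ Finset.range m, b k • T k = ∑ n ∈ Finset.range m, c n • e n := by
    simp only [hT, hc, Finset.smul_sum, Finset.sum_smul, smul_smul]
    refine Finset.sum_comm' fun k n => ?_
    simp only [Finset.mem_range, Finset.mem_Ico]
    omega
  have hPS : P (∑ n ∈ Finset.range m, c n • e n) = ∑ n ∈ Finset.Ico N m, c n • e n := by
    have h1 : ∀ n ∈ Finset.range N,
        inner ℂ (e n) (∑ n ∈ Finset.range m, c n • e n) • e n = c n • e n := by
      intro n hn
      rw [he.inner_right_sum c (by simp only [Finset.mem_range] at hn ⊢; omega)]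
    simp only [hP]
    rw [Finset.sum_congr rfl h1, Finset.sum_Ico_eq_sub _ hm]
  have hsq : ‖∑ n ∈ Finset.Ico N m, c n • e n‖ ^ 2 = ∑ n ∈ Finset.Ico N m, ‖c n‖ ^ 2 := by
    have h1 := he.inner_sum c c (Finset.Ico N m)
    have h2 : ∀ n, (starRingEnd ℂ) (c n) * c n = ((‖c n‖ ^ 2 : ℝ) : ℂ) := by
      intro n
      rw [mul_comm, Complex.mul_conj, Complex.normSq_eq_norm_sq]
    simp only [h2] at h1
    rw [← inner_self_eq_norm_sq (𝕜 := ℂ), h1, ← Complex.ofReal_sum]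
    rfl
  have hgeom : ∑ n ∈ Finset.Ico N m, ‖c n‖ ^ 2 ≤ A ^ 2 * ((r ^ 2) ^ N / (1 - r ^ 2)) := by
    calc ∑ n ∈ Finset.Ico N m, ‖c n‖ ^ 2 ≤ ∑ n ∈ Finset.Ico N m, A ^ 2 * (r ^ 2) ^ n := by
          refine Finset.sum_le_sum fun n hn => ?_
          have := hA n (Finset.mem_Ico.1 hn).1 m
          calc ‖c n‖ ^ 2 ≤ (A * r ^ n) ^ 2 := by gcongr
            _ = _ := by ring
      _ = A ^ 2 * ∑ n ∈ Finset.Ico N m, (r ^ 2) ^ n := by rw [Finset.mul_sum]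
      _ ≤ _ := by
          gcongr
          exact geom_sum_Ico_le_of_lt_one (by positivity) (by linarith)
  simp only [Function.comp_apply]
  rw [hS, hPS]
  refine le_of_sq_le_sq ?_ (by positivity)
  rw [hsq, div_pow, Real.sq_sqrt hr2.le]
  refine hgeom.trans_eq ?_
  ring

end Hilbert

/-! ### Jacobi polynomials in the weighted `L²` space. -/

section Measure

open Polynomial

variable {α β : ℝ}

theorem isFiniteMeasure_jacobiMeasure (hα : -1 < α) (hβ : -1 < β) :
    IsFiniteMeasure (jacobiMeasure α β) :=
  isFiniteMeasure_withDensity_ofReal (integrableOn_jacobiWeight hα hβ).2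

theorem integral_jacobiMeasure (f : ℝ → ℂ) :
    ∫ x, f x ∂(jacobiMeasure α β) = ∫ x in Set.Ioo (-1 : ℝ) 1, (jacobiWeight α β x : ℂ) * f x := by
  rw [jacobiMeasure, integral_withDensity_eq_integral_toReal_smul
    (measurable_jacobiWeight α β).ennreal_ofReal (by simp)]
  refine setIntegral_congr_fun measurableSet_Ioo fun x hx => ?_
  rw [ENNReal.toReal_ofReal (jacobiWeight_pos hx).le, Complex.real_smul]

theorem ae_jacobiMeasure_mem_Ioo : ∀ᵐ x ∂(jacobiMeasure α β), x ∈ Set.Ioo (-1 : ℝ) 1 :=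
  (withDensity_absolutelyContinuous _ _).ae_le (ae_restrict_mem measurableSet_Ioo)

theorem memLp_jacobiMeasure (hα : -1 < α) (hβ : -1 < β) {f : ℝ → ℂ}
    (hf : ContinuousOn f (Set.Icc (-1) 1)) : MemLp f 2 (jacobiMeasure α β) := by
  have := isFiniteMeasure_jacobiMeasure hα hβ
  obtain ⟨C, hC⟩ := isCompact_Icc.exists_bound_of_continuousOn hf
  refine MemLp.of_bound ?_ C ?_
  · exact ((hf.mono Set.Ioo_subset_Icc_self).aestronglyMeasurable measurableSet_Ioo).mono_ac
      (withDensity_absolutelyContinuous _ _)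
  · filter_upwards [ae_jacobiMeasure_mem_Ioo] with x hx using hC x (Set.Ioo_subset_Icc_self hx)

theorem memLp_polynomial (hα : -1 < α) (hβ : -1 < β) (p : ℂ[X]) :
    MemLp (fun x : ℝ => p.eval (x : ℂ)) 2 (jacobiMeasure α β) :=
  memLp_jacobiMeasure hα hβ (p.continuous.comp Complex.continuous_ofReal).continuousOn

/-- Polynomials as elements of the weighted `L²` space. -/
noncomputable def polynomialLp (hα : -1 < α) (hβ : -1 < β) :
    ℂ[X] →ₗ[ℂ] Lp ℂ 2 (jacobiMeasure α β) where
  toFun p := (memLp_polynomial hα hβ p).toLp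
  map_add' p q := by
    rw [← MemLp.toLp_add]
    exact MemLp.toLp_congr _ _ (by simp [Pi.add_def])
  map_smul' c p := by
    rw [RingHom.id_apply, ← MemLp.toLp_const_smul]
    exact MemLp.toLp_congr _ _ (by simp [Pi.smul_def])

theorem polynomialLp_apply (hα : -1 < α) (hβ : -1 < β) (p : ℂ[X]) :
    polynomialLp hα hβ p = (memLp_polynomial hα hβ p).toLp := rfl

theorem inner_toLp_jacobiMeasure {f g : ℝ → ℂ} (hf : MemLp f 2 (jacobiMeasure α β))
    (hg : MemLp g 2 (jacobiMeasure α β)) :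
    inner ℂ hf.toLp hg.toLp = ∫ x in Set.Ioo (-1 : ℝ) 1,
      (jacobiWeight α β x : ℂ) * (g x * (starRingEnd ℂ) (f x)) := by
  rw [L2.inner_def, ← integral_jacobiMeasure]
  refine integral_congr_ae ?_
  filter_upwards [hf.coeFn_toLp, hg.coeFn_toLp] with x h1 h2
  rw [h1, h2]
  rfl

theorem inner_polynomialLp_map (hα : -1 < α) (hβ : -1 < β) (p q : ℝ[X]) :
    inner ℂ (polynomialLp hα hβ (p.map Complex.ofRealHom))
      (polynomialLp hα hβ (q.map Complex.ofRealHom)) = (jacobiInt α β (q * p) : ℂ) := by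
  rw [polynomialLp_apply, polynomialLp_apply, inner_toLp_jacobiMeasure, jacobiInt,
    ← integral_complex_ofReal]
  refine setIntegral_congr_fun measurableSet_Ioo fun x _ => ?_
  have h : ∀ r : ℝ[X], (r.map Complex.ofRealHom).eval (x : ℂ) = (r.eval x : ℝ) := fun r => by
    rw [← Complex.ofRealHom_eq_coe, eval_map_apply]
    rfl
  simp only [h, Complex.conj_ofReal, eval_mul]
  push_cast
  ring

theorem jacobiInt_jacobiPoly_of_ne (hα : -1 < α) (hβ : -1 < β) {m n : ℕ} (h : m ≠ n) :
    jacobiInt α β (jacobiPoly α β m * jacobiPoly α β n) = 0 := by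
  rcases h.lt_or_gt with h | h
  · exact jacobiInt_mul_jacobiPoly_of_natDegree_lt hα hβ
      ((natDegree_jacobiPoly_le α β m).trans_lt h)
  · rw [mul_comm]
    exact jacobiInt_mul_jacobiPoly_of_natDegree_lt hα hβ
      ((natDegree_jacobiPoly_le α β n).trans_lt h)

theorem coeff_jacobiPoly_ne_zero (hα : -1 < α) (hβ : -1 < β) (n : ℕ) :
    (jacobiPoly α β n).coeff n ≠ 0 := by
  intro h
  have := jacobiInt_jacobiPoly_sq hα hβ n
  rw [jacobiInt_mul_jacobiPoly_of_natDegree_le hα hβ (natDegree_jacobiPoly_le α β n), h] at this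
  have h2 := jacobiGamma_pos hα hβ n
  simp at this
  linarith

theorem exists_eq_sum_jacobiPoly (hα : -1 < α) (hβ : -1 < β) {k : ℕ} {q : ℝ[X]}
    (hq : q.natDegree < k) :
    ∃ c : ℕ → ℝ, q = ∑ n ∈ Finset.range k, C (c n) * jacobiPoly α β n := by
  -- With `degree` in place of `natDegree` the induction can start at `k = 0`, where `q = 0`.
  have main : ∀ k : ℕ, ∀ q : ℝ[X], q.degree < k →
      ∃ c : ℕ → ℝ, q = ∑ n ∈ Finset.range k, C (c n) * jacobiPoly α β n := by
    intro k
    induction k with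
    | zero =>
      intro q hq
      have : q = 0 := by
        rw [← degree_eq_bot]
        exact Nat.WithBot.lt_zero_iff.1 (by simpa using hq)
      exact ⟨0, by simp [this]⟩
    | succ k ih =>
      intro q hq
      set a := q.coeff k / (jacobiPoly α β k).coeff k with ha
      obtain ⟨c, hc⟩ := ih (q - C a * jacobiPoly α β k) (by
        rw [degree_lt_iff_coeff_zero] at hq ⊢
        intro j hj
        rcases hj.eq_or_lt with rfl | hj
        · rw [coeff_sub, coeff_C_mul, ha, div_mul_cancel₀ _ (coeff_jacobiPoly_ne_zero hα hβ k),
            sub_self]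
        · rw [coeff_sub, coeff_C_mul, hq j hj, coeff_eq_zero_of_natDegree_lt
            ((natDegree_jacobiPoly_le α β k).trans_lt hj)]
          simp)
      refine ⟨Function.update c k a, ?_⟩
      rw [Finset.sum_range_succ, Function.update_self]
      have : ∑ n ∈ Finset.range k, C (Function.update c k a n) * jacobiPoly α β n =
          ∑ n ∈ Finset.range k, C (c n) * jacobiPoly α β n := by
        refine Finset.sum_congr rfl fun n hn => ?_
        rw [Function.update_of_ne (Finset.mem_range.1 hn).ne]
      rw [this, ← hc]
      ring
  refine main k q (lt_of_le_of_lt degree_le_natDegree ?_)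
  exact_mod_cast hq

/-- The orthonormal Jacobi polynomials in the weighted `L²` space. -/
noncomputable def jacobiOrtho (hα : -1 < α) (hβ : -1 < β) (n : ℕ) : Lp ℂ 2 (jacobiMeasure α β) :=
  (((Real.sqrt (jacobiGamma α β n))⁻¹ : ℝ) : ℂ) •
    polynomialLp hα hβ ((jacobiPoly α β n).map Complex.ofRealHom)

theorem inner_jacobiOrtho_polynomialLp (hα : -1 < α) (hβ : -1 < β) (n : ℕ) (q : ℝ[X]) :
    inner ℂ (jacobiOrtho hα hβ n) (polynomialLp hα hβ (q.map Complex.ofRealHom)) =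
      ((jacobiInt α β (q * jacobiPoly α β n) / Real.sqrt (jacobiGamma α β n) : ℝ) : ℂ) := by
  rw [jacobiOrtho, inner_smul_left, inner_polynomialLp_map, Complex.conj_ofReal]
  push_cast
  ring

theorem orthonormal_jacobiOrtho (hα : -1 < α) (hβ : -1 < β) :
    Orthonormal ℂ (jacobiOrtho hα hβ) := by
  rw [orthonormal_iff_ite]
  intro m n
  have h : inner ℂ (jacobiOrtho hα hβ m) (jacobiOrtho hα hβ n) =
      (((Real.sqrt (jacobiGamma α β n))⁻¹ : ℝ) : ℂ) * inner ℂ (jacobiOrtho hα hβ m)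
        (polynomialLp hα hβ ((jacobiPoly α β n).map Complex.ofRealHom)) := by
    rw [← inner_smul_right]
    rfl
  rw [h, inner_jacobiOrtho_polynomialLp]
  split_ifs with hmn
  · subst hmn
    rw [jacobiInt_jacobiPoly_sq hα hβ, Real.div_sqrt, ← Complex.ofReal_mul, inv_mul_cancel₀]
    · simp
    · exact (Real.sqrt_pos.2 (jacobiGamma_pos hα hβ m)).ne'
  · rw [jacobiInt_jacobiPoly_of_ne hα hβ (Ne.symm hmn)]
    simp

theorem polynomialLp_eq_sum (hα : -1 < α) (hβ : -1 < β) {k : ℕ} {q : ℝ[X]}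
    (hq : q.natDegree < k) :
    polynomialLp hα hβ (q.map Complex.ofRealHom) = ∑ n ∈ Finset.range k,
      ((jacobiInt α β (q * jacobiPoly α β n) / Real.sqrt (jacobiGamma α β n) : ℝ) : ℂ) •
        jacobiOrtho hα hβ n := by
  obtain ⟨c, hc⟩ := exists_eq_sum_jacobiPoly hα hβ hq
  have h1 : polynomialLp hα hβ (q.map Complex.ofRealHom) = ∑ n ∈ Finset.range k,
      ((c n * Real.sqrt (jacobiGamma α β n) : ℝ) : ℂ) • jacobiOrtho hα hβ n := by
    conv_lhs => rw [hc]
    rw [Polynomial.map_sum, map_sum]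
    refine Finset.sum_congr rfl fun n _ => ?_
    have hs := (Real.sqrt_pos.2 (jacobiGamma_pos hα hβ n)).ne'
    rw [Polynomial.map_mul, Polynomial.map_C, ← smul_eq_C_mul, map_smul, jacobiOrtho, smul_smul,
      ← Complex.ofReal_mul, mul_assoc, mul_inv_cancel₀ hs, mul_one]
    rfl
  have h2 := h1
  rw [h1]
  refine Finset.sum_congr rfl fun n hn => ?_
  rw [← inner_jacobiOrtho_polynomialLp hα hβ, h2, (orthonormal_jacobiOrtho hα hβ).inner_right_sum _ hn]

theorem norm_polynomialLp_chebyshev_le (hα : -1 < α) (hβ : -1 < β) (k : ℕ) :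
    ‖polynomialLp hα hβ ((Chebyshev.T ℝ (k : ℤ)).map Complex.ofRealHom)‖ ≤
      Real.sqrt (jacobiGamma α β 0) := by
  refine Real.le_sqrt_of_sq_le ?_
  have h := inner_polynomialLp_map hα hβ (Chebyshev.T ℝ (k : ℤ)) (Chebyshev.T ℝ (k : ℤ))
  have h2 : ‖polynomialLp hα hβ ((Chebyshev.T ℝ (k : ℤ)).map Complex.ofRealHom)‖ ^ 2 =
      jacobiInt α β (Chebyshev.T ℝ (k : ℤ) * Chebyshev.T ℝ (k : ℤ)) := by
    rw [← inner_self_eq_norm_sq (𝕜 := ℂ), h]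
    rfl
  rw [h2, ← jacobiInt_one_eq_jacobiGamma_zero hα hβ]
  refine setIntegral_mono_on (integrableOn_jacobiWeight_mul hα hβ _)
    (integrableOn_jacobiWeight_mul hα hβ _) measurableSet_Ioo fun x hx => ?_
  have hx1 := Chebyshev.abs_eval_T_real_le_one (k : ℤ) (abs_le.2 ⟨hx.1.le, hx.2.le⟩)
  refine mul_le_mul_of_nonneg_left ?_ (jacobiWeight_pos hx).le
  rw [eval_mul, eval_one, ← pow_two, ← sq_abs]
  exact pow_le_one₀ (abs_nonneg _) hx1

theorem continuousOn_of_mem_bernsteinAnalytic {ρ : ℝ} (hρ : 1 < ρ) {u : ℂ → ℂ}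
    (hu : u ∈ bernsteinAnalytic ρ) : ContinuousOn (fun x : ℝ => u x) (Set.Icc (-1) 1) := by
  intro x hx
  have hmem : (x : ℂ) ∈ bernsteinRegion ρ := by
    have h := joukowski_mem_bernsteinRegion hρ (w := Complex.exp (Real.arccos x * Complex.I))
      (by rw [Complex.norm_exp_ofReal_mul_I]) (by rw [Complex.norm_exp_ofReal_mul_I]; exact hρ.le)
    rwa [← Complex.exp_neg, ← neg_mul, ← Complex.cos, ← Complex.ofReal_cos,
      Real.cos_arccos hx.1 hx.2] at h
  exact ((hu _ hmem).continuousAt.comp (f := fun x : ℝ => (x : ℂ))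
    Complex.continuous_ofReal.continuousAt).continuousWithinAt

theorem inner_jacobiOrtho_toLp (hα : -1 < α) (hβ : -1 < β) (n : ℕ) {u : ℂ → ℂ}
    (hu : MemLp (fun x : ℝ => u x) 2 (jacobiMeasure α β)) :
    inner ℂ (jacobiOrtho hα hβ n) hu.toLp =
      (Real.sqrt (jacobiGamma α β n) : ℂ) * jacobiCoeff α β u n := by
  have hs : (Real.sqrt (jacobiGamma α β n) : ℂ) ≠ 0 := by
    exact_mod_cast (Real.sqrt_pos.2 (jacobiGamma_pos hα hβ n)).ne'
  have hg : (jacobiGamma α β n : ℂ) =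
      Real.sqrt (jacobiGamma α β n) * Real.sqrt (jacobiGamma α β n) := by
    rw [← Complex.ofReal_mul, Real.mul_self_sqrt (jacobiGamma_pos hα hβ n).le]
  have hI : ∫ x in (-1 : ℝ)..1, u (x : ℂ) * (jacobiP α β n x : ℂ) * (jacobiWeight α β x : ℂ) =
      ∫ x in Set.Ioo (-1 : ℝ) 1, (jacobiWeight α β x : ℂ) * (u x * (starRingEnd ℂ)
        (((jacobiPoly α β n).map Complex.ofRealHom).eval (x : ℂ))) := by
    rw [intervalIntegral.integral_of_le (by norm_num), integral_Ioc_eq_integral_Ioo]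
    refine setIntegral_congr_fun measurableSet_Ioo fun x hx => ?_
    have h : ((jacobiPoly α β n).map Complex.ofRealHom).eval (x : ℂ) = (jacobiP α β n x : ℝ) := by
      rw [jacobiP_eq_eval α β n hx, ← Complex.ofRealHom_eq_coe, eval_map_apply]
      rfl
    simp only [h, Complex.conj_ofReal]
    ring
  rw [jacobiOrtho, inner_smul_left, polynomialLp_apply, inner_toLp_jacobiMeasure, jacobiCoeff, hI,
    Complex.conj_ofReal, Complex.ofReal_inv, Complex.ofReal_inv, hg]
  field_simp

theorem jacobiL2Norm_eq (hα : -1 < α) (hβ : -1 < β) (N : ℕ) {u : ℂ → ℂ}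
    (hu : MemLp (fun x : ℝ => u x) 2 (jacobiMeasure α β)) :
    jacobiL2Norm α β (fun x => jacobiProj α β N u x - u (x : ℂ)) =
      ENNReal.ofReal ‖hu.toLp - ∑ n ∈ Finset.range N,
        inner ℂ (jacobiOrtho hα hβ n) hu.toLp • jacobiOrtho hα hβ n‖ := by
  set p : ℂ[X] := ∑ n ∈ Finset.range N,
    jacobiCoeff α β u n • (jacobiPoly α β n).map Complex.ofRealHom with hp
  have h1 : ∑ n ∈ Finset.range N, inner ℂ (jacobiOrtho hα hβ n) hu.toLp • jacobiOrtho hα hβ n =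
      polynomialLp hα hβ p := by
    rw [hp, map_sum]
    refine Finset.sum_congr rfl fun n _ => ?_
    have hs : (Real.sqrt (jacobiGamma α β n) : ℂ) ≠ 0 := by
      exact_mod_cast (Real.sqrt_pos.2 (jacobiGamma_pos hα hβ n)).ne'
    rw [inner_jacobiOrtho_toLp, jacobiOrtho, smul_smul, map_smul, Complex.ofReal_inv,
      mul_right_comm, mul_inv_cancel₀ hs, one_mul]
  rw [h1, polynomialLp_apply, norm_sub_rev, ← MemLp.toLp_sub, Lp.norm_toLp,
    ENNReal.ofReal_toReal ((memLp_polynomial hα hβ p).sub hu).2.ne]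
  refine eLpNorm_congr_ae ?_
  -- The Rodrigues quotient `jacobiP` is identified with a polynomial on the open interval, which
  -- suffices almost everywhere.
  filter_upwards [ae_jacobiMeasure_mem_Ioo] with x hx
  have h : ∀ n, ((jacobiPoly α β n).map Complex.ofRealHom).eval (x : ℂ) =
      (jacobiP α β n x : ℝ) := fun n => by
    rw [jacobiP_eq_eval α β n hx, ← Complex.ofRealHom_eq_coe, eval_map_apply]
    rfl
  simp only [jacobiProj, Pi.sub_apply, hp, eval_finsetSum, eval_smul, smul_eq_mul, h]

/-- Since `|T_k| ≤ 1`, the tails are uniformly geometric on the interval, and the measure is finite.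
-/
theorem tendsto_sum_chebyshev (hα : -1 < α) (hβ : -1 < β) {u : ℂ → ℂ} {b : ℕ → ℂ} {B r : ℝ}
    (hr0 : 0 ≤ r) (hr1 : r < 1) (hb : ∀ k, ‖b k‖ ≤ B * r ^ k)
    (hsum : ∀ x ∈ Set.Icc (-1 : ℝ) 1,
      HasSum (fun k : ℕ => b k * ((Chebyshev.T ℝ (k : ℤ)).eval x : ℝ)) (u x))
    (hu : MemLp (fun x : ℝ => u x) 2 (jacobiMeasure α β)) :
    Filter.Tendsto (fun m => ∑ k ∈ Finset.range m,
      b k • polynomialLp hα hβ ((Chebyshev.T ℝ (k : ℤ)).map Complex.ofRealHom))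
      Filter.atTop (nhds hu.toLp) := by
  have := isFiniteMeasure_jacobiMeasure hα hβ
  rw [tendsto_iff_norm_sub_tendsto_zero]
  have hbound : ∀ m : ℕ, ‖∑ k ∈ Finset.range m, b k • polynomialLp hα hβ
      ((Chebyshev.T ℝ (k : ℤ)).map Complex.ofRealHom) - hu.toLp‖ ≤
      (measureUnivNNReal (jacobiMeasure α β) : ℝ) ^ (2 : ENNReal).toReal⁻¹ *
        (B * r ^ m / (1 - r)) := by
    intro m
    have hB : 0 ≤ B := by simpa using (norm_nonneg _).trans (hb 0)
    have e : ∑ k ∈ Finset.range m, b k • polynomialLp hα hβ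
        ((Chebyshev.T ℝ (k : ℤ)).map Complex.ofRealHom) = polynomialLp hα hβ
          (∑ k ∈ Finset.range m, b k • (Chebyshev.T ℝ (k : ℤ)).map Complex.ofRealHom) := by
      simp
    rw [e, polynomialLp_apply, ← MemLp.toLp_sub]
    refine Lp.norm_le_of_ae_bound (div_nonneg (by positivity) (by linarith)) ?_
    filter_upwards [((memLp_polynomial hα hβ _).sub hu).coeFn_toLp, ae_jacobiMeasure_mem_Ioo]
      with x h1 hx
    rw [h1]
    have hx' := Set.Ioo_subset_Icc_self hx
    have h : ∀ r : ℝ[X], (r.map Complex.ofRealHom).eval (x : ℂ) = (r.eval x : ℝ) := fun r => by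
      rw [← Complex.ofRealHom_eq_coe, eval_map_apply]
      rfl
    simp only [Pi.sub_apply, eval_finsetSum, eval_smul, smul_eq_mul, h]
    rw [← dist_eq_norm]
    refine dist_le_of_le_geometric_of_tendsto r B hr1 (fun k => ?_) (hsum x hx').tendsto_sum_nat m
    rw [dist_comm, dist_eq_norm, Finset.sum_range_succ, add_sub_cancel_left, norm_mul]
    have hT := Chebyshev.abs_eval_T_real_le_one (k : ℤ) (abs_le.2 hx')
    calc _ ≤ ‖b k‖ * 1 := by
          gcongr
          rwa [Complex.norm_real]
      _ ≤ _ := by rw [mul_one]; exact hb k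
  refine squeeze_zero (fun m => norm_nonneg _) hbound ?_
  have h0 := tendsto_pow_atTop_nhds_zero_of_lt_one hr0 hr1
  simpa using ((h0.const_mul B).div_const (1 - r)).const_mul
    ((measureUnivNNReal (jacobiMeasure α β) : ℝ) ^ (2 : ENNReal).toReal⁻¹)

end Measure

/-! ### Bounds for the connection coefficients, and conclusion. -/

section Main

open Polynomial

variable {α β : ℝ}

/-- Cauchy–Schwarz; used for the tail `k ≥ n + 2`. -/
theorem abs_jacobiInt_chebyshev_le (hα : -1 < α) (hβ : -1 < β) (n k : ℕ) :
    |jacobiInt α β (Chebyshev.T ℝ (k : ℤ) * jacobiPoly α β n) / Real.sqrt (jacobiGamma α β n)| ≤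
      Real.sqrt (jacobiGamma α β 0) := by
  have h := norm_inner_le_norm (𝕜 := ℂ) (jacobiOrtho hα hβ n)
    (polynomialLp hα hβ ((Chebyshev.T ℝ (k : ℤ)).map Complex.ofRealHom))
  rw [inner_jacobiOrtho_polynomialLp, Complex.norm_real, (orthonormal_jacobiOrtho hα hβ).1 n,
    one_mul] at h
  exact h.trans (norm_polynomialLp_chebyshev_le hα hβ k)

theorem exists_abs_jacobiInt_chebyshev_le (hα : -1 < α) (hβ : -1 < β) :
    ∃ K : ℝ, 0 ≤ K ∧ ∀ n : ℕ, 1 ≤ n →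
      2 * |jacobiInt α β (Chebyshev.T ℝ (n : ℤ) * jacobiPoly α β n) /
          Real.sqrt (jacobiGamma α β n)| ≤
        Real.sqrt (Real.pi / 2 ^ (α + β)) * (1 + K / n) ∧
      2 * |jacobiInt α β (Chebyshev.T ℝ ((n + 1 : ℕ) : ℤ) * jacobiPoly α β n) /
          Real.sqrt (jacobiGamma α β n)| ≤
        |α - β| * (Real.sqrt (Real.pi / 2 ^ (α + β)) * (1 + K / n)) := by
  obtain ⟨K, hK, h⟩ := exists_jacobiInt_le hα hβ
  refine ⟨K, hK, fun n hn => ?_⟩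
  have hn1 : (1 : ℝ) ≤ n := by exact_mod_cast hn
  obtain ⟨h1, h2⟩ := h n hn
  have hB := jacobiInt_one_pos (a := α + n) (b := β + n) (by linarith) (by linarith)
  have hs := Real.sqrt_pos.2 (jacobiGamma_pos hα hβ n)
  have habs : ∀ x : ℝ, 2 * |x| = |2 * x| := fun x => by rw [abs_mul, abs_two]
  constructor
  · rw [habs, ← mul_div_assoc, jacobiInt_chebyshev_self hα hβ (by omega),
      abs_of_pos (div_pos hB hs)]
    exact h1
  · have hq : 0 ≤ (2 * n + 2) / (2 * n + α + β + 2) *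
        (jacobiInt (α + n) (β + n) 1 / Real.sqrt (jacobiGamma α β n)) := by
      have : 0 < 2 * n + α + β + 2 := by linarith
      positivity
    rw [habs, ← mul_div_assoc, jacobiInt_chebyshev_succ hα hβ n, mul_assoc, mul_div_assoc, abs_mul,
      mul_div_assoc, abs_of_nonneg hq, abs_sub_comm]
    gcongr

theorem sum_Ico_le_of_le_geometric {f : ℕ → ℝ} (hf : ∀ k, 0 ≤ f k) {a0 a1 G B r : ℝ} {n : ℕ}
    (hr0 : 0 ≤ r) (hr1 : r < 1) (hB : 0 ≤ B) (hG : 0 ≤ G) (h0 : f n ≤ B * r ^ n * a0)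
    (h1 : f (n + 1) ≤ B * r ^ (n + 1) * a1) (h2 : ∀ k, f k ≤ B * r ^ k * G) (m : ℕ) :
    ∑ k ∈ Finset.Ico n m, f k ≤ B * (a0 + r * a1 + G * r ^ 2 / (1 - r)) * r ^ n := by
  -- The range is lengthened so that it contains both special terms for every `m`.
  have hle : ∑ k ∈ Finset.Ico n m, f k ≤ ∑ k ∈ Finset.Ico n (n + (m + 2)), f k :=
    Finset.sum_le_sum_of_subset_of_nonneg (Finset.Ico_subset_Ico le_rfl (by omega))
      fun k _ _ => hf k
  refine hle.trans ?_
  rw [Finset.sum_Ico_eq_sum_range, Nat.add_sub_cancel_left, Finset.sum_range_succ',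
    Finset.sum_range_succ']
  have hg : ∑ j ∈ Finset.range m, r ^ j ≤ 1 / (1 - r) := by
    rw [one_div, ← tsum_geometric_of_lt_one hr0 hr1]
    exact (summable_geometric_of_lt_one hr0 hr1).sum_le_tsum _ fun _ _ => by positivity
  have ht : ∑ j ∈ Finset.range m, f (n + (j + 1 + 1)) ≤ B * r ^ n * G * r ^ 2 * (1 / (1 - r)) := by
    calc _ ≤ ∑ j ∈ Finset.range m, B * r ^ n * G * r ^ 2 * r ^ j := by
          refine Finset.sum_le_sum fun j _ => (h2 _).trans_eq ?_
          ring
      _ = B * r ^ n * G * r ^ 2 * ∑ j ∈ Finset.range m, r ^ j := by rw [Finset.mul_sum]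
      _ ≤ _ := by gcongr
  simp only [zero_add, add_zero]
  calc _ ≤ B * r ^ n * G * r ^ 2 * (1 / (1 - r)) + B * r ^ (n + 1) * a1 + B * r ^ n * a0 := by
        gcongr
    _ = _ := by ring

end Main

theorem mainTheorem5 (α β : ℝ) (hα : -1 < α) (hβ : -1 < β) :
    ∃ C : ℕ → ℝ,
      (fun N : ℕ => C N - 1) =O[Filter.atTop] (fun N : ℕ => 1 / (N : ℝ)) ∧
      ∀ ρ : ℝ, 1 < ρ → ∀ u ∈ bernsteinAnalytic ρ, ∀ N : ℕ, 1 ≤ N →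
        jacobiL2Norm α β (fun x => jacobiProj α β N u x - u (x : ℂ)) ≤
          ENNReal.ofReal
            ((Real.sqrt (Real.pi / (2 : ℝ) ^ (α + β)) * (1 + |α - β| / ρ)
                + 2 * Real.sqrt (jacobiGamma α β 0) / (ρ * (ρ - 1)))
              * (C N * bernsteinMax ρ u / (ρ ^ (N - 1) * Real.sqrt (ρ ^ 2 - 1)))) := by
  obtain ⟨K, hK, hcoef⟩ := exists_abs_jacobiInt_chebyshev_le hα hβ
  refine ⟨fun N => 1 + K / N, isBigO_one_add_div_sub_one K, fun ρ hρ u hu N hN => ?_⟩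
  have hρ0 : 0 < ρ := by linarith
  obtain ⟨b, hb, hsum⟩ := exists_chebyshev_expansion hρ hu
  have hmem := memLp_jacobiMeasure hα hβ (continuousOn_of_mem_bernsteinAnalytic hρ hu)
  have hr0 : 0 ≤ ρ⁻¹ := by positivity
  have hr1 : ρ⁻¹ < 1 := inv_lt_one_of_one_lt₀ hρ
  set M := bernsteinMax ρ u
  set S := Real.sqrt (Real.pi / (2 : ℝ) ^ (α + β))
  set G := Real.sqrt (jacobiGamma α β 0)
  set c := 1 + K / (N : ℝ) with hc
  have hM : 0 ≤ 2 * M := by simpa using (norm_nonneg _).trans (hb 0)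
  have hM' : 0 ≤ M := by linarith
  have hS : 0 ≤ S := Real.sqrt_nonneg _
  have hG : 0 ≤ G := Real.sqrt_nonneg _
  have hc1 : 1 ≤ c := le_add_of_nonneg_right (by positivity)
  have hr1' : 0 < 1 - ρ⁻¹ := by linarith
  have hnorm := (orthonormal_jacobiOrtho hα hβ).norm_sub_sum_inner_le
    (T := fun k => polynomialLp hα hβ
      ((Polynomial.Chebyshev.T ℝ (k : ℤ)).map Complex.ofRealHom))
    (t := fun n k => ((jacobiInt α β (Polynomial.Chebyshev.T ℝ (k : ℤ) * jacobiPoly α β n) /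
      Real.sqrt (jacobiGamma α β n) : ℝ) : ℂ))
    (fun k => polynomialLp_eq_sum hα hβ (by simp [Polynomial.Chebyshev.natDegree_T]))
    (tendsto_sum_chebyshev hα hβ hr0 hr1 hb hsum hmem) (N := N) hr0 hr1
    -- The terms come from `k = n`, `k = n + 1` and `k ≥ n + 2`. The halves undo the 2 in `‖b k‖ ≤ 2
    -- M ρ⁻ᵏ`, and `c ≥ 1` is put into the last term to be a common factor.
    (A := 2 * M * (S * c / 2 + ρ⁻¹ * (|α - β| * (S * c) / 2) + c * G * ρ⁻¹ ^ 2 / (1 - ρ⁻¹)))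
    (by positivity) fun n hn m => ?_
  · rw [jacobiL2Norm_eq hα hβ N hmem]
    refine ENNReal.ofReal_le_ofReal (hnorm.trans_eq ?_)
    have hsq : Real.sqrt (1 - ρ⁻¹ ^ 2) = Real.sqrt (ρ ^ 2 - 1) / ρ := by
      have : 1 - ρ⁻¹ ^ 2 = (ρ ^ 2 - 1) / ρ ^ 2 := by field_simp
      rw [this, Real.sqrt_div' _ (by positivity), Real.sqrt_sq hρ0.le]
    have hpow : ρ ^ N = ρ ^ (N - 1) * ρ := by rw [← pow_succ, Nat.sub_add_cancel hN]
    have hs : Real.sqrt (ρ ^ 2 - 1) ≠ 0 := (Real.sqrt_pos.2 (by nlinarith)).ne'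
    have hρ1 : ρ - 1 ≠ 0 := by linarith
    have h1r : 1 - ρ⁻¹ = (ρ - 1) / ρ := by field_simp
    simp only [hsq, h1r, inv_pow ρ N, hpow, ← hc]
    field_simp
  -- `1 + K / n` decreases in `n`, so its value at `N` serves all `n ≥ N`.
  · have hcn : 1 + K / (n : ℝ) ≤ c := by
      have : (0 : ℝ) < N := by exact_mod_cast hN
      have : (N : ℝ) ≤ n := by exact_mod_cast hn
      rw [hc]
      gcongr
    obtain ⟨h1, h2⟩ := hcoef n (hN.trans hn)
    have hSc : S * (1 + K / (n : ℝ)) ≤ S * c := by gcongr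
    have hSc2 : |α - β| * (S * (1 + K / (n : ℝ))) ≤ |α - β| * (S * c) := by gcongr
    refine (norm_sum_le _ _).trans ?_
    refine sum_Ico_le_of_le_geometric (fun k => norm_nonneg _) hr0 hr1 hM (by positivity) ?_ ?_
      (fun k => ?_) m
    all_goals
      rw [norm_mul, Complex.norm_real, Real.norm_eq_abs]
      refine mul_le_mul (hb _) ?_ (abs_nonneg _) (by positivity)
    · linarith
    · linarith
    · refine (abs_jacobiInt_chebyshev_le hα hβ n k).trans ?_
      exact le_mul_of_one_le_left hG hc1
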